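/- **Model.** For every density $\lambda>0$, the base stations (BSs) form a homogeneous Poisson point process of intensity $\lambda$ in $\mathbb{R}^2$, numbered by increasing distances $r_0\le r_1\le\cdots$ from the origin, where the tagged user $0$ is located. BS $i$ serves user $i$. BSs have $N_t(\lambda)\ge 1$ antennas and users have $N_r(\lambda)\ge 1$ antennas. The channels $H_{i,j}\in\mathbb{C}^{N_r\times N_t}$ from BS $i$ to user $j$ have i.i.d. $\mathcal{CN}(0,1)$ entries and are independent of the BS positions. Under eigenbeamforming with a single stream, $(u_i,p_i)$ is a pair of unit left and right singular vectors of $H_{i,i}$ for its largest singular value, chosen by a measurable rule from $H_{i,i}$ alone. For noise variance $\sigma^2\ge 0$ and a path loss function $L:[0,\infty)\to[0,\infty)$, put $$\mathrm{SINR}(\lambda)=\frac{L(r_0)\,|u_0^*H_{0,0}p_0|^2}{\sum_{i\ge 1}L(r_i)\,|u_0^*H_{i,0}p_i|^2+\|u_0\|^2\sigma^2},\qquad \mathcal{E}(\lambda)=\lambda\log_2\bigl(1+\mathrm{SINR}(\lambda)\bigr).$$ The MISO case with $N$ antennas is the case of $N$ transmit antennas and one receive antenna. **Assumptions.** $L$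 is measurable, continuous at $0$, $L(r)\le L(0)<\infty$ for all $r\ge 0$, and $0<\int_0^\infty rL(r)\,dr<\infty$. Further, there are $\rho\ge 0$, $\zeta>0$, $\lambda_c\ge 0$ and a positive differentiable decreasing function $\tilde L$ on $[\rho,\infty)$ with $\tilde L\le L$ and $r\tilde L(r)\ge -\zeta\tilde L'(r)$ on $[\rho,\infty)$ and $\int_{\rho}^\infty \frac{r}{\tilde L(r)^2}e^{-\pi\lambda_0r^2}\,dr<\infty$ for all $\lambda_0>\lambda_c$. Finally, $N_t$ is non-decreasing, $N_t(\lambda)\to\infty$, and $N_r(\lambda)/N_t(\lambda)\to y\in[0,1]$ as $\lambda\to\infty$. **Corollary 2.** For every $\lambda>0$ the interference $\sum_{i\ge1}L(r_i)|u_0^*H_{i,0}p_i|^2$ is almost surely finite, and for all large $\lambda$ the averages below are finite. There are constants $c,C>0$ such that for all sufficiently large $\lambda$ $$c\,\frac{N_t(\lambda)}{\lambda}\le \mathbb{E}[\mathrm{SINR}(\lambda)]\le C\,\frac{N_t(\lambda)N_r(\lambda)}{\lambda}$$ and $$c\,\lambda\log_2\Bigl(1+\frac{N_t(\lambda)}{\lambda}\Bigr)\le\mathbb{E}[\mathcal{E}(\lambda)]\le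 C\,\lambda\log_2\Bigl(1+\frac{N_t(\lambda)N_r(\lambda)}{\lambda}\Bigr).$$ Moreover, if $\mathcal{E}^{\mathrm{MISO}}_N(\lambda)$ denotes the ASE of a MISO network with $N$ transmit antennas, then $c\,\mathbb{E}[\mathcal{E}^{\mathrm{MISO}}_{N_t(\lambda)}(\lambda)]\le\mathbb{E}[\mathcal{E}(\lambda)]\le C\,\mathbb{E}[\mathcal{E}^{\mathrm{MISO}}_{N_t(\lambda)N_r(\lambda)}(\lambda)]$ for all sufficiently large $\lambda$. -/

import Mathlib

open MeasureTheory ProbabilityTheory Filter Topology Asymptotics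
open scoped ENNReal NNReal

noncomputable section

namespace Cellular

/-- The plane in which the base stations live. -/
abbrev Plane : Type := EuclideanSpace ℝ (Fin 2)

/-- The number of points of the enumerated configuration `x` that lie in `B`
(with multiplicity, possibly infinite). -/
def pointCount (x : ℕ → Plane) (B : Set Plane) : ℝ≥0∞ :=
  Measure.sum (fun i => Measure.dirac (x i)) B

/-- The random points `X 0, X 1, …` form a homogeneous Poisson point process of intensity `lam`
on the plane (with respect to Lebesgue measure), enumerated by increasing distance from the
origin: `X 0` is the point closest to the origin. -/
structure IsPoissonProcess {Ω : Type*} [MeasurableSpace Ω] (P : Measure Ω) (lam : ℝ)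
    (X : ℕ → Ω → Plane) : Prop where
  measurable : ∀ i, Measurable (X i)
  ordered : ∀ᵐ ω ∂P, Monotone fun i => ‖X i ω‖
  poisson : ∀ B : Set Plane, MeasurableSet B → volume B ≠ ∞ →
    P.map (fun ω => pointCount (fun i => X i ω) B)
      = (poissonMeasure (lam * (volume B).toReal).toNNReal).map (fun k : ℕ => (k : ℝ≥0∞))
  indep : ∀ (n : ℕ) (B : Fin n → Set Plane), (∀ j, MeasurableSet (B j)) →
    (∀ j, volume (B j) ≠ ∞) → Pairwise (fun j k => Disjoint (B j) (B k)) →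
    iIndepFun (fun j ω => pointCount (fun i => X i ω) (B j)) P

/-- The circularly symmetric complex Gaussian distribution with zero mean and unit variance. -/
def stdComplexGaussian : Measure ℂ :=
  ((gaussianReal 0 (1 / 2)).prod (gaussianReal 0 (1 / 2))).map fun z => (⟨z.1, z.2⟩ : ℂ)

/-- Channel matrices with `nr` receive and `nt` transmit antennas. -/
abbrev Channel (nr nt : ℕ) : Type := Fin nr → Fin nt → ℂ

/-- A channel matrix as a linear map between Euclidean (Hermitian) spaces. -/
def channelMap {nr nt : ℕ} (H : Channel nr nt) :
    EuclideanSpace ℂ (Fin nt) →ₗ[ℂ] EuclideanSpace ℂ (Fin nr) :=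
  Matrix.toEuclideanLin (Matrix.of H)

/-- The largest singular value of a channel matrix. -/
def maxSingularValue {nr nt : ℕ} (H : Channel nr nt) : ℝ :=
  (channelMap H).singularValues 0

/-- `u` and `p` are unit left and right singular vectors of `H`, belonging to its largest
singular value. -/
def IsTopSingularPair {nr nt : ℕ} (H : Channel nr nt)
    (u : EuclideanSpace ℂ (Fin nr)) (p : EuclideanSpace ℂ (Fin nt)) : Prop :=
  ‖u‖ = 1 ∧ ‖p‖ = 1 ∧
    channelMap H p = (maxSingularValue H : ℂ) • u ∧
    (channelMap H).adjoint u = (maxSingularValue H : ℂ) • p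

/-- The random data of a downlink network whose base stations have `nt` antennas and whose users
have `nr` antennas. Base station `i` serves user `i`, base stations are numbered by their
distance from the origin, and user `0` is the tagged user, located at the origin.
* `bs i` is the position of base station `i`;
* `chan i j` is the small-scale channel matrix from base station `i` to user `j`;
* `combiner i` and `precoder i` are the beamforming rules of the `i`th user and of the `i`th base
  station; they see only the channel `chan i i` between the two. -/
structure Network (Ω : Type*) (nt nr : ℕ) where
  bs : ℕ → Ω → Plane
  chan : ℕ → ℕ → Ω → Channel nr nt
  combiner : ℕ → Channel nr nt → EuclideanSpace ℂ (Fin nr)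
  precoder : ℕ → Channel nr nt → EuclideanSpace ℂ (Fin nt)

namespace Network

variable {Ω : Type*} {nt nr : ℕ}

/-- The network follows the model with base station density `lam` and eigenbeamforming: the base
stations form a Poisson process, all channel coefficients are i.i.d. standard complex Gaussian and
independent of the positions, and the beamforming vectors are top singular vectors. -/
structure IsEigenbeamforming [MeasurableSpace Ω] (N : Network Ω nt nr) (P : Measure Ω)
    (lam : ℝ) : Prop where
  poisson : IsPoissonProcess P lam N.bs
  measurable_chan : ∀ i j, Measurable (N.chan i j)
  law_chan : ∀ i j a b, P.map (fun ω => N.chan i j ω a b) = stdComplexGaussian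
  indep_chan : iIndepFun
    (fun (q : (ℕ × ℕ) × (Fin nr × Fin nt)) ω => N.chan q.1.1 q.1.2 ω q.2.1 q.2.2) P
  indep_bs_chan : IndepFun (fun ω i => N.bs i ω) (fun ω i j => N.chan i j ω) P
  measurable_combiner : ∀ i, Measurable (N.combiner i)
  measurable_precoder : ∀ i, Measurable (N.precoder i)
  singular : ∀ i H, IsTopSingularPair H (N.combiner i H) (N.precoder i H)

/-- The combining vector `u i` in use. -/
def combVec (N : Network Ω nt nr) (i : ℕ) (ω : Ω) : EuclideanSpace ℂ (Fin nr) :=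
  N.combiner i (N.chan i i ω)

/-- The beamforming vector `p i` in use. -/
def precVec (N : Network Ω nt nr) (i : ℕ) (ω : Ω) : EuclideanSpace ℂ (Fin nt) :=
  N.precoder i (N.chan i i ω)

/-- The effective small-scale power gain `|u₀* H_{i,0} p_i|²` from base station `i` to the tagged
user. -/
def gain (N : Network Ω nt nr) (i : ℕ) (ω : Ω) : ℝ :=
  ‖inner ℂ (N.combVec 0 ω) (channelMap (N.chan i 0 ω) (N.precVec i ω))‖ ^ 2

/-- The power received by the tagged user from base station `i`. -/
def power (N : Network Ω nt nr) (L : ℝ → ℝ) (i : ℕ) (ω : Ω) : ℝ :=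
  L ‖N.bs i ω‖ * N.gain i ω

/-- The conditional SINR of the tagged user, with path loss `1 / L` and noise variance `σ2`. -/
def sinr (N : Network Ω nt nr) (L : ℝ → ℝ) (σ2 : ℝ) (ω : Ω) : ℝ :=
  N.power L 0 ω / ((∑' i, N.power L (i + 1) ω) + ‖N.combVec 0 ω‖ ^ 2 * σ2)

/-- The conditional area spectral efficiency. -/
def ase (N : Network Ω nt nr) (L : ℝ → ℝ) (σ2 lam : ℝ) (ω : Ω) : ℝ :=
  lam * Real.logb 2 (1 + N.sinr L σ2 ω)

/-- The average SINR. -/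
def avgSinr [MeasurableSpace Ω] (N : Network Ω nt nr) (P : Measure Ω) (L : ℝ → ℝ) (σ2 : ℝ) : ℝ :=
  ∫ ω, N.sinr L σ2 ω ∂P

/-- The average area spectral efficiency. -/
def avgAse [MeasurableSpace Ω] (N : Network Ω nt nr) (P : Measure Ω) (L : ℝ → ℝ)
    (σ2 lam : ℝ) : ℝ :=
  ∫ ω, N.ase L σ2 lam ω ∂P

end Network

/-- Physically feasible path loss functions. Only the values of `L` on `[0, ∞)` matter. -/
structure PhysicallyFeasible (L : ℝ → ℝ) : Prop where
  measurable : Measurable L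
  nonneg : ∀ r, 0 ≤ r → 0 ≤ L r
  le_zero : ∀ r, 0 ≤ r → L r ≤ L 0
  integrable : IntegrableOn (fun r => r * L r) (Set.Ioi 0)
  integral_pos : 0 < ∫ r in Set.Ioi (0 : ℝ), r * L r

/-- The additional tail condition on the path loss function: it has a positive, differentiable,
decreasing minorant `Lt` on some `[r₀, ∞)` with `r Lt(r) / (-Lt'(r)) ≥ ζ` (read as `+∞ ≥ ζ` where
`Lt'(r) = 0`), and `r Lt(r)⁻² exp(-π λ₀ r²)` is integrable on it for all `λ₀` beyond a critical
value. -/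
def TailCondition (L : ℝ → ℝ) : Prop :=
  ∃ (r₀ ζ : ℝ) (Lt Lt' : ℝ → ℝ), 0 ≤ r₀ ∧ 0 < ζ ∧
    (∀ r ∈ Set.Ici r₀, 0 < Lt r) ∧
    AntitoneOn Lt (Set.Ici r₀) ∧
    (∀ r ∈ Set.Ici r₀, HasDerivWithinAt Lt (Lt' r) (Set.Ici r₀) r) ∧
    (∀ r ∈ Set.Ici r₀, Lt r ≤ L r) ∧
    (∀ r ∈ Set.Ici r₀, ζ * (-Lt' r) ≤ r * Lt r) ∧
    ∃ lamc : ℝ, 0 ≤ lamc ∧ ∀ lam₀ > lamc,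
      IntegrableOn (fun r => r / Lt r ^ 2 * Real.exp (-(Real.pi * lam₀ * r ^ 2))) (Set.Ioi r₀)

end Cellular

end

/-! ### Standard complex Gaussian variables -/

namespace Cellular

/-! Everything rests on bounds for one network whose constants depend neither on the density nor on
the antenna numbers (`exists_average_bounds`). Write `G i` for the gains and `I` for the
interference.

Upper bound. The SINR is at most `L 0 * G 0 / I`, and `G 0` is at most the squared Frobenius norm of
the channel, whose mean is `nt * nr`. An interfering channel is Gaussian and independent of the unit
vectors through which it is seen, so the interfering gains are independent exponential variables,
independent also of `G 0`. Writing `1 / s` as the integral of `exp (-t s)` gives `E[G 0 / ∑ i ∈ S, G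
i] = E[G 0] / (|S| - 1)` for a set `S` of at least two interferers (`lintegral_gain_zero_div_sum`).
Given the positions, `S` is chosen as follows. A fixed small disc, on which `L` is at least `L 0 /
2`, typically contains a number of stations proportional to the density, and this yields a ratio of
order `nt * nr / lam`. If the disc is sparse, three stations in the first annulus that has so many
are used instead. The price is the inverse of the path loss on that annulus; it is paid with a
probability exponentially small in both the density and the area of the preceding annulus, and the
tail condition makes the resulting series converge (`lintegral_gain_zero_div_tsum_le`,
`exists_lintegral_gain_zero_div_interference_le`).

Lower bound. With probability at least 1/2, the nearest station lies in the disc (Poisson Chernoff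
bound), `G 0 ≥ nt / 2` (Chernoff bound for one row of the channel), and `I` is of order at most
`lam` (Campbell and Markov). Then the SINR is at least a constant times `nt / lam`
(`measure_sinr_lt_le`).

The spectral efficiency follows from Jensen's inequality above and Markov's inequality below, since
constants can be moved out of `log₂ (1 + ·)`. For one receive antenna the two bounds have the same
order, so the comparisons with MISO networks follow by transitivity. -/

lemma measurable_complex_mk : Measurable fun z : ℝ × ℝ => (⟨z.1, z.2⟩ : ℂ) :=
  Complex.measurableEquivRealProd.symm.measurable

instance : IsProbabilityMeasure stdComplexGaussian :=
  Measure.isProbabilityMeasure_map measurable_complex_mk.aemeasurable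

lemma charFun_stdComplexGaussian (t : ℂ) :
    charFun stdComplexGaussian t = Complex.exp (-(‖t‖ ^ 2 : ℝ) / 4) := by
  have h : charFun stdComplexGaussian t
      = charFun (gaussianReal 0 (1 / 2)) t.re * charFun (gaussianReal 0 (1 / 2)) t.im := by
    rw [charFun_apply, stdComplexGaussian, integral_map measurable_complex_mk.aemeasurable
      (by fun_prop), charFun_apply_real, charFun_apply_real, ← integral_prod_mul]
    congr 1 with z
    rw [← Complex.exp_add]
    congr 1
    simp [Complex.inner, mul_comm, mul_add]
  rw [h, charFun_gaussianReal, charFun_gaussianReal, ← Complex.exp_add, ← Complex.normSq_eq_norm_sq,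
    Complex.normSq_apply]
  congr 1
  push_cast
  ring

lemma charFun_map_const_mul (c t : ℂ) (μ : Measure ℂ) :
    charFun (μ.map fun z => c * z) t = charFun μ ((starRingEnd ℂ) c * t) := by
  rw [charFun_apply, integral_map (by fun_prop) (by fun_prop), charFun_apply]
  congr 1 with z
  congr 2
  simp only [Complex.inner, map_mul]
  ring_nf

/-- A linear combination of independent standard complex Gaussian variables is a standard complex
Gaussian variable if its coefficients have unit `ℓ²` norm. -/
lemma map_sum_mul_eq_stdComplexGaussian {Ω ι : Type*} [MeasurableSpace Ω] [Fintype ι]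
    {P : Measure Ω} [IsProbabilityMeasure P] {Z : ι → Ω → ℂ} (hZ : ∀ i, Measurable (Z i))
    (hlaw : ∀ i, P.map (Z i) = stdComplexGaussian) (hind : iIndepFun Z P) (c : ι → ℂ)
    (hc : ∑ i, ‖c i‖ ^ 2 = 1) :
    P.map (fun ω => ∑ i, c i * Z i ω) = stdComplexGaussian := by
  have hm : Measurable (fun ω => ∑ i, c i * Z i ω) :=
    Finset.measurable_sum _ fun i _ => (hZ i).const_mul _
  have := Measure.isProbabilityMeasure_map (μ := P) hm.aemeasurable
  refine Measure.ext_of_charFun (funext fun t => ?_)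
  have hi : iIndepFun (fun i ω => c i * Z i ω) P :=
    hind.comp (fun i z => c i * z) fun i => by fun_prop
  rw [hi.charFun_map_fun_sum_eq_prod fun i => ((hZ i).const_mul _).aemeasurable]
  have hone (i : ι) : charFun (P.map fun ω => c i * Z i ω) t
      = Complex.exp (-(‖c i‖ ^ 2 * ‖t‖ ^ 2 : ℝ) / 4) := by
    have : P.map (fun ω => c i * Z i ω) = (P.map (Z i)).map fun z => c i * z := by
      rw [Measure.map_map (by fun_prop) (hZ i)]; rfl
    rw [this, hlaw, charFun_map_const_mul, charFun_stdComplexGaussian]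
    simp [mul_pow]
  rw [Finset.prod_apply]
  simp_rw [hone]
  rw [← Complex.exp_sum, charFun_stdComplexGaussian, ← Finset.sum_div, Finset.sum_neg_distrib,
    ← Complex.ofReal_sum, ← Finset.sum_mul, hc, one_mul]

lemma lintegral_exp_gaussianReal {t : ℝ} (ht : 0 ≤ t) :
    ∫⁻ x, ENNReal.ofReal (Real.exp (-(t * x ^ 2))) ∂(gaussianReal 0 (1 / 2))
      = ENNReal.ofReal ((√(1 + t))⁻¹) := by
  have hint : Integrable (fun x : ℝ => Real.exp (-(t * x ^ 2))) (gaussianReal 0 (1 / 2)) := by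
    refine Integrable.of_bound (C := 1) (by fun_prop) (ae_of_all _ fun x => ?_)
    rw [Real.norm_eq_abs, Real.abs_exp, Real.exp_le_one_iff]
    nlinarith [mul_nonneg ht (sq_nonneg x)]
  rw [← ofReal_integral_eq_lintegral_ofReal hint (ae_of_all _ fun x => (Real.exp_pos _).le),
    integral_gaussianReal_eq_integral_smul (by norm_num)]
  congr 1
  have (x : ℝ) : gaussianPDFReal 0 (1 / 2) x • Real.exp (-(t * x ^ 2))
      = (√Real.pi)⁻¹ * Real.exp (-(1 + t) * x ^ 2) := by
    rw [gaussianPDFReal, smul_eq_mul, mul_assoc, ← Real.exp_add]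
    congr 2
    · rw [show 2 * Real.pi * ((1 / 2 : ℝ≥0) : ℝ) = Real.pi by push_cast; ring]
    · push_cast
      ring
  simp_rw [this]
  rw [integral_const_mul, integral_gaussian, Real.sqrt_div Real.pi_pos.le]
  have := Real.sqrt_pos.mpr Real.pi_pos
  field_simp

/-- The squared modulus is an exponential variable of mean one, and this is its Laplace transform;
each coordinate has variance 1/2 and contributes a factor `(1 + t) ^ (-1/2)`. -/
lemma lintegral_exp_stdComplexGaussian {t : ℝ} (ht : 0 ≤ t) :
    ∫⁻ z, ENNReal.ofReal (Real.exp (-(t * ‖z‖ ^ 2))) ∂stdComplexGaussian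
      = ENNReal.ofReal ((1 + t)⁻¹) := by
  rw [stdComplexGaussian, lintegral_map (by fun_prop) measurable_complex_mk]
  have (z : ℝ × ℝ) : ENNReal.ofReal (Real.exp (-(t * ‖(⟨z.1, z.2⟩ : ℂ)‖ ^ 2)))
      = ENNReal.ofReal (Real.exp (-(t * z.1 ^ 2))) * ENNReal.ofReal (Real.exp (-(t * z.2 ^ 2))) := by
    rw [← ENNReal.ofReal_mul (by positivity), ← Real.exp_add, ← Complex.normSq_eq_norm_sq,
      Complex.normSq_apply]
    ring_nf
  simp_rw [this]
  rw [lintegral_prod_mul (f := fun x : ℝ => ENNReal.ofReal (Real.exp (-(t * x ^ 2))))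
      (g := fun x : ℝ => ENNReal.ofReal (Real.exp (-(t * x ^ 2)))) (by fun_prop) (by fun_prop),
    lintegral_exp_gaussianReal ht,
    ← ENNReal.ofReal_mul (by positivity), ← mul_inv, Real.mul_self_sqrt (by positivity)]

lemma lintegral_sq_gaussianReal :
    ∫⁻ x, ENNReal.ofReal (x ^ 2) ∂(gaussianReal 0 (1 / 2)) = ENNReal.ofReal (1 / 2) := by
  have h := variance_fun_id_gaussianReal (μ := 0) (v := 1 / 2)
  rw [variance_eq_integral (by fun_prop)] at h
  rw [← ofReal_integral_eq_lintegral_ofReal]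
  · congr 1
    simpa using h
  · exact (memLp_id_gaussianReal 2).integrable_sq
  · exact ae_of_all _ fun x => sq_nonneg x

lemma lintegral_norm_sq_stdComplexGaussian :
    ∫⁻ z, ENNReal.ofReal (‖z‖ ^ 2) ∂stdComplexGaussian = 1 := by
  rw [stdComplexGaussian, lintegral_map (by fun_prop) measurable_complex_mk]
  have (z : ℝ × ℝ) : ENNReal.ofReal (‖(⟨z.1, z.2⟩ : ℂ)‖ ^ 2)
      = ENNReal.ofReal (z.1 ^ 2) * 1 + 1 * ENNReal.ofReal (z.2 ^ 2) := by
    rw [mul_one, one_mul, ← ENNReal.ofReal_add (by positivity) (by positivity),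
      ← Complex.normSq_eq_norm_sq, Complex.normSq_apply]
    ring_nf
  simp_rw [this]
  rw [lintegral_add_left (by fun_prop),
    lintegral_prod_mul (f := fun x : ℝ => ENNReal.ofReal (x ^ 2)) (g := fun _ => 1)
      (by fun_prop) (by fun_prop),
    lintegral_prod_mul (f := fun _ => 1) (g := fun x : ℝ => ENNReal.ofReal (x ^ 2))
      (by fun_prop) (by fun_prop), lintegral_sq_gaussianReal]
  simp only [lintegral_const, measure_univ, mul_one, one_mul]
  rw [← ENNReal.ofReal_add (by positivity) (by positivity)]
  norm_num

end Cellular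

/-! ### Beamforming gains: singular values, independence, moments -/

namespace Cellular

/-- Independence of whole blocks, for possibly infinite index sets: the σ-algebra generated by a
block is the supremum of those of its members. -/
lemma indepFun_restrict_of_disjoint {Ω ι β : Type*} [MeasurableSpace Ω] [MeasurableSpace β]
    {P : Measure Ω} {Z : ι → Ω → β} (hZ : ∀ i, Measurable (Z i)) (hind : iIndepFun Z P)
    {S T : Set ι} (hST : Disjoint S T) :
    IndepFun (fun ω (i : S) => Z i ω) (fun ω (i : T) => Z i ω) P := by
  have key (S : Set ι) : MeasurableSpace.comap (fun ω (i : S) => Z i ω) MeasurableSpace.pi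
      = ⨆ i ∈ S, MeasurableSpace.comap (Z i) inferInstance := by
    simp only [MeasurableSpace.pi, MeasurableSpace.comap_iSup, MeasurableSpace.comap_comp,
      iSup_subtype']
    rfl
  rw [IndepFun_iff_Indep, key, key]
  exact indep_iSup_of_disjoint (fun i => (hZ i).comap_le) hind.iIndep hST

section Linear

variable {nr nt : ℕ}

lemma inner_channelMap (H : Channel nr nt) (u : EuclideanSpace ℂ (Fin nr))
    (p : EuclideanSpace ℂ (Fin nt)) :
    inner ℂ u (channelMap H p)
      = ∑ q : Fin nr × Fin nt, (starRingEnd ℂ (u q.1) * p q.2) * H q.1 q.2 := by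
  rw [channelMap, PiLp.inner_apply, Fintype.sum_prod_type]
  refine Finset.sum_congr rfl fun a _ => ?_
  rw [Matrix.ofLp_toLpLin, Matrix.toLin'_apply, RCLike.inner_apply, Matrix.mulVec, dotProduct,
    Finset.sum_mul]
  refine Finset.sum_congr rfl fun b _ => ?_
  rw [Matrix.of_apply]
  ring

lemma sum_norm_sq_coeff {u : EuclideanSpace ℂ (Fin nr)} {p : EuclideanSpace ℂ (Fin nt)}
    (hu : ‖u‖ = 1) (hp : ‖p‖ = 1) :
    ∑ q : Fin nr × Fin nt, ‖starRingEnd ℂ (u q.1) * p q.2‖ ^ 2 = 1 := by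
  have h1 := EuclideanSpace.norm_sq_eq u
  have h2 := EuclideanSpace.norm_sq_eq p
  rw [hu, one_pow] at h1
  rw [hp, one_pow] at h2
  simp_rw [norm_mul, mul_pow, RCLike.norm_conj]
  rw [Fintype.sum_prod_type]
  simp_rw [← Finset.mul_sum]
  rw [← h2, ← Finset.sum_mul, ← h1, one_mul]

/-- Cauchy–Schwarz: the gain pairs the entries of `H` with a rank-one coefficient matrix of unit
Frobenius norm. -/
lemma norm_inner_channelMap_sq_le (H : Channel nr nt) {u : EuclideanSpace ℂ (Fin nr)}
    {p : EuclideanSpace ℂ (Fin nt)} (hu : ‖u‖ = 1) (hp : ‖p‖ = 1) :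
    ‖inner ℂ u (channelMap H p)‖ ^ 2 ≤ ∑ q : Fin nr × Fin nt, ‖H q.1 q.2‖ ^ 2 := by
  rw [inner_channelMap]
  calc _ ≤ (∑ q : Fin nr × Fin nt, ‖starRingEnd ℂ (u q.1) * p q.2‖ * ‖H q.1 q.2‖) ^ 2 := by
        gcongr
        refine (norm_sum_le _ _).trans (Finset.sum_le_sum fun q _ => ?_)
        rw [norm_mul (_ * _)]
    _ ≤ _ := Finset.sum_mul_sq_le_sq_mul_sq _ _ _
    _ = _ := by rw [sum_norm_sq_coeff hu hp, one_mul]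

/-- In an eigenbasis of `T* T` the left side is a sum of eigenvalues weighted by squared
coordinates, and the squared top singular value is the largest eigenvalue. -/
lemma norm_channelMap_sq_le (hnt : 0 < nt) (H : Channel nr nt) (v : EuclideanSpace ℂ (Fin nt)) :
    ‖channelMap H v‖ ^ 2 ≤ maxSingularValue H ^ 2 * ‖v‖ ^ 2 := by
  have hn : Module.finrank ℂ (EuclideanSpace ℂ (Fin nt)) = nt := by simp
  set T := channelMap H
  have hs := T.isSymmetric_adjoint_comp_self
  rw [maxSingularValue, T.sq_singularValues_of_lt hn hnt]
  set b := hs.eigenvectorBasis hn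
  have h1 : ‖T v‖ ^ 2 = RCLike.re (inner ℂ v ((T.adjoint ∘ₗ T) v)) := by
    rw [LinearMap.comp_apply, LinearMap.adjoint_inner_right, inner_self_eq_norm_sq]
  have h2 (i : Fin nt) : RCLike.re (inner ℂ v (b i) * inner ℂ (b i) ((T.adjoint ∘ₗ T) v))
      = hs.eigenvalues hn i * ‖inner ℂ (b i) v‖ ^ 2 := by
    rw [← hs, hs.apply_eigenvectorBasis hn, inner_smul_left, RCLike.conj_ofReal,
      mul_left_comm, RCLike.re_ofReal_mul, ← inner_conj_symm v, RCLike.conj_mul]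
    norm_cast
  rw [h1, ← b.sum_inner_mul_inner, map_sum, ← b.sum_sq_norm_inner_right, Finset.mul_sum]
  refine Finset.sum_le_sum fun i _ => ?_
  rw [h2]
  gcongr
  exact hs.eigenvalues_antitone hn (Fin.le_def.2 (Nat.zero_le _))

/-- Apply `H` to the conjugate `v` of its row `a`: entry `a` of `H v` is `R = ‖v‖ ^ 2`, so `R ^ 2`
is at most the squared top singular value times `R`. -/
lemma row_le_maxSingularValue_sq (H : Channel nr nt) (a : Fin nr) :
    ∑ b, ‖H a b‖ ^ 2 ≤ maxSingularValue H ^ 2 := by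
  rcases Nat.eq_zero_or_pos nt with rfl | hnt
  · simp [sq_nonneg]
  set R := ∑ b, ‖H a b‖ ^ 2
  set v : EuclideanSpace ℂ (Fin nt) := WithLp.toLp 2 fun b => starRingEnd ℂ (H a b)
  have hv : ‖v‖ ^ 2 = R := by
    rw [EuclideanSpace.norm_sq_eq]
    exact Finset.sum_congr rfl fun b _ => by simp [v]
  have hR : 0 ≤ R := by positivity
  have h1 : channelMap H v a = (R : ℂ) := by
    rw [channelMap, Matrix.ofLp_toLpLin, Matrix.toLin'_apply, Matrix.mulVec, dotProduct]
    simp only [R, Complex.ofReal_sum]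
    exact Finset.sum_congr rfl fun b _ => by simp [v, Complex.mul_conj, Complex.normSq_eq_norm_sq]
  have h2 : R ≤ ‖channelMap H v‖ := by
    have := PiLp.norm_apply_le (channelMap H v) a
    rwa [h1, Complex.norm_real, Real.norm_of_nonneg hR] at this
  have h3 := norm_channelMap_sq_le hnt H v
  rw [hv] at h3
  rcases hR.eq_or_lt with h0 | h0
  · rw [← h0]; positivity
  · nlinarith

lemma IsTopSingularPair.norm_inner_sq {H : Channel nr nt} {u : EuclideanSpace ℂ (Fin nr)}
    {p : EuclideanSpace ℂ (Fin nt)} (h : IsTopSingularPair H u p) :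
    ‖inner ℂ u (channelMap H p)‖ ^ 2 = maxSingularValue H ^ 2 := by
  rw [h.2.2.1, inner_smul_right, inner_self_eq_norm_sq_to_K, h.1]
  simp [maxSingularValue]

lemma measurable_inner_channelMap {α : Type*} [MeasurableSpace α] {H : α → Channel nr nt}
    {u : α → EuclideanSpace ℂ (Fin nr)} {p : α → EuclideanSpace ℂ (Fin nt)}
    (hH : Measurable H) (hu : Measurable u) (hp : Measurable p) :
    Measurable fun x => inner ℂ (u x) (channelMap (H x) (p x)) := by
  simp_rw [inner_channelMap]
  have h1 (a : Fin nr) : Measurable fun x => u x a :=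
    (measurable_pi_apply a).comp ((WithLp.measurable_ofLp 2 _).comp hu)
  have h2 (a : Fin nt) : Measurable fun x => p x a :=
    (measurable_pi_apply a).comp ((WithLp.measurable_ofLp 2 _).comp hp)
  have h3 (q : Fin nr × Fin nt) : Measurable fun x => H x q.1 q.2 :=
    (measurable_pi_apply q.2).comp ((measurable_pi_apply q.1).comp hH)
  exact Finset.measurable_fun_sum _ fun q _ =>
    ((Complex.continuous_conj.measurable.comp (h1 q.1)).mul (h2 q.2)).mul (h3 q)

end Linear

/-- A channel matrix with independent standard complex Gaussian entries, independent of `Y`, is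
seen through beamforming vectors that depend on `Y` only as a standard complex Gaussian variable
independent of `Y`. -/
lemma lintegral_mul_comp_inner_channelMap {Ω E : Type*} [MeasurableSpace Ω] [MeasurableSpace E]
    {P : Measure Ω} [IsProbabilityMeasure P] {nr nt : ℕ} {Y : Ω → E} {B : Ω → Channel nr nt}
    (hY : Measurable Y) (hB : Measurable B) (hYB : IndepFun Y B P)
    (hlaw : ∀ a b, P.map (fun ω => B ω a b) = stdComplexGaussian)
    (hind : iIndepFun (fun (q : Fin nr × Fin nt) ω => B ω q.1 q.2) P)
    {u : E → EuclideanSpace ℂ (Fin nr)} {p : E → EuclideanSpace ℂ (Fin nt)}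
    (hu : Measurable u) (hp : Measurable p) (hu1 : ∀ y, ‖u y‖ = 1) (hp1 : ∀ y, ‖p y‖ = 1)
    {Φ : E → ℝ≥0∞} (hΦ : Measurable Φ) {ψ : ℂ → ℝ≥0∞} (hψ : Measurable ψ) :
    ∫⁻ ω, Φ (Y ω) * ψ (inner ℂ (u (Y ω)) (channelMap (B ω) (p (Y ω)))) ∂P
      = (∫⁻ ω, Φ (Y ω) ∂P) * ∫⁻ z, ψ z ∂stdComplexGaussian := by
  have hm : Measurable fun y : E × Channel nr nt => inner ℂ (u y.1) (channelMap y.2 (p y.1)) :=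
    measurable_inner_channelMap (H := fun y : E × Channel nr nt => y.2)
      (u := fun y : E × Channel nr nt => u y.1) (p := fun y : E × Channel nr nt => p y.1)
      measurable_snd (hu.comp measurable_fst) (hp.comp measurable_fst)
  have hF : Measurable fun y : E × Channel nr nt =>
      Φ y.1 * ψ (inner ℂ (u y.1) (channelMap y.2 (p y.1))) :=
    (hΦ.comp measurable_fst).mul (hψ.comp hm)
  have hZ (q : Fin nr × Fin nt) : Measurable fun ω => B ω q.1 q.2 :=
    (measurable_pi_apply q.2).comp ((measurable_pi_apply q.1).comp hB)
  have hfix (y : E) : ∫⁻ ω, ψ (inner ℂ (u y) (channelMap (B ω) (p y))) ∂P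
      = ∫⁻ z, ψ z ∂stdComplexGaussian := by
    rw [← map_sum_mul_eq_stdComplexGaussian hZ (fun q => hlaw q.1 q.2) hind
      (fun q => starRingEnd ℂ (u y q.1) * p y q.2) (sum_norm_sq_coeff (hu1 y) (hp1 y)),
      lintegral_map hψ (Finset.measurable_fun_sum _ fun q _ => (hZ q).const_mul _)]
    simp_rw [inner_channelMap]
  have := Measure.isProbabilityMeasure_map (μ := P) hB.aemeasurable
  have := Measure.isProbabilityMeasure_map (μ := P) hY.aemeasurable
  have hmy (y : E) : Measurable fun H : Channel nr nt => ψ (inner ℂ (u y) (channelMap H (p y))) :=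
    hψ.comp (measurable_inner_channelMap (H := fun H => H) (u := fun _ => u y) (p := fun _ => p y)
      measurable_id measurable_const measurable_const)
  calc ∫⁻ ω, Φ (Y ω) * ψ (inner ℂ (u (Y ω)) (channelMap (B ω) (p (Y ω)))) ∂P
      = ∫⁻ y, Φ y.1 * ψ (inner ℂ (u y.1) (channelMap y.2 (p y.1)))
          ∂(P.map fun ω => (Y ω, B ω)) := (lintegral_map hF (hY.prodMk hB)).symm
    _ = ∫⁻ y, ∫⁻ H, Φ y * ψ (inner ℂ (u y) (channelMap H (p y))) ∂(P.map B) ∂(P.map Y) := by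
        rw [hYB.map_prod_eq_prod_map_map hY.aemeasurable hB.aemeasurable,
          lintegral_prod _ hF.aemeasurable]
    _ = ∫⁻ y, Φ y * ∫⁻ z, ψ z ∂stdComplexGaussian ∂(P.map Y) := by
        congr 1 with y
        rw [lintegral_const_mul _ (hmy y), lintegral_map (hmy y) hB, hfix]
    _ = _ := by rw [lintegral_mul_const _ hΦ, lintegral_map hΦ hY]

namespace Network

set_option linter.unusedSectionVars false

variable {Ω : Type*} {nt nr : ℕ}

/-- The power gain as a function of all the channels. -/
noncomputable def gainOf (N : Network Ω nt nr) (i : ℕ) (h : ℕ → ℕ → Channel nr nt) : ℝ :=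
  ‖inner ℂ (N.combiner 0 (h 0 0)) (channelMap (h i 0) (N.precoder i (h i i)))‖ ^ 2

lemma gain_eq_gainOf (N : Network Ω nt nr) (i : ℕ) (ω : Ω) :
    N.gain i ω = N.gainOf i fun j k => N.chan j k ω := rfl

lemma gain_nonneg (N : Network Ω nt nr) (i : ℕ) (ω : Ω) : 0 ≤ N.gain i ω := sq_nonneg _

namespace IsEigenbeamforming

variable [MeasurableSpace Ω] {P : Measure Ω} [IsProbabilityMeasure P] {N : Network Ω nt nr}
  {lam : ℝ}

lemma measurable_entry (hN : N.IsEigenbeamforming P lam) (i j : ℕ) (a : Fin nr) (b : Fin nt) :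
    Measurable fun ω => N.chan i j ω a b :=
  measurable_pi_iff.1 (measurable_pi_iff.1 (hN.measurable_chan i j) a) b

lemma measurable_allChan (hN : N.IsEigenbeamforming P lam) :
    Measurable fun ω j k => N.chan j k ω :=
  measurable_pi_iff.2 fun j => measurable_pi_iff.2 fun k => hN.measurable_chan j k

lemma measurable_gainOf (hN : N.IsEigenbeamforming P lam) (i : ℕ) :
    Measurable (N.gainOf i) := by
  have h (j k : ℕ) : Measurable fun h : ℕ → ℕ → Channel nr nt => h j k :=
    (measurable_pi_apply k).comp (measurable_pi_apply j)
  exact ((measurable_inner_channelMap (h i 0) ((hN.measurable_combiner 0).comp (h 0 0))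
    ((hN.measurable_precoder i).comp (h i i))).norm).pow_const 2

lemma measurable_gain (hN : N.IsEigenbeamforming P lam) (i : ℕ) : Measurable (N.gain i) := by
  have h := (hN.measurable_gainOf i).comp hN.measurable_allChan
  rwa [show N.gain i = N.gainOf i ∘ fun ω j k => N.chan j k ω from
    funext fun ω => N.gain_eq_gainOf i ω]

/-- Conditionally on all other channels, the gain of an interferer is distributed like the squared
modulus of a standard complex Gaussian variable. -/
lemma lintegral_mul_comp_gain (hN : N.IsEigenbeamforming P lam) {i : ℕ} (hi : i ≠ 0)
    {Φ : (ℕ → ℕ → Channel nr nt) → ℝ≥0∞} (hΦ : Measurable Φ)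
    (hΦi : ∀ h h', (∀ j k, (j, k) ≠ (i, 0) → h j k = h' j k) → Φ h = Φ h')
    {ψ : ℝ → ℝ≥0∞} (hψ : Measurable ψ) :
    ∫⁻ ω, Φ (fun j k => N.chan j k ω) * ψ (N.gain i ω) ∂P
      = (∫⁻ ω, Φ (fun j k => N.chan j k ω) ∂P) * ∫⁻ z, ψ (‖z‖ ^ 2) ∂stdComplexGaussian := by
  classical
  -- Erasing the channel `(i, 0)` leaves a variable independent of it that still determines `Φ` and
  -- both beamforming vectors, as these use only the channels `(0, 0)` and `(i, i)`.
  let mask : (ℕ → ℕ → Channel nr nt) → ℕ → ℕ → Channel nr nt :=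
    fun h j k => if (j, k) = (i, 0) then 0 else h j k
  have hmask : Measurable mask := by
    refine measurable_pi_iff.2 fun j => measurable_pi_iff.2 fun k => ?_
    by_cases h : (j, k) = (i, 0)
    · simp only [mask, h, if_true]; exact measurable_const
    · simp only [mask, h, if_false]
      exact (measurable_pi_apply k).comp (measurable_pi_apply j)
  have hind : IndepFun (fun ω => mask fun j k => N.chan j k ω) (N.chan i 0) P := by
    have h0 := indepFun_restrict_of_disjoint (S := {q : (ℕ × ℕ) × (Fin nr × Fin nt) | q.1 ≠ (i, 0)})
      (T := {q | q.1 = (i, 0)})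
      (fun q => hN.measurable_entry q.1.1 q.1.2 q.2.1 q.2.2) hN.indep_chan (Set.disjoint_left.2 fun q h h' => h h')
    have h1 : Measurable fun (y : {q : (ℕ × ℕ) × (Fin nr × Fin nt) | q.1 ≠ (i, 0)} → ℂ)
        (j k : ℕ) (a : Fin nr) (b : Fin nt) =>
        if h : (j, k) = (i, 0) then (0 : ℂ) else y ⟨((j, k), (a, b)), h⟩ := by
      refine measurable_pi_iff.2 fun j => measurable_pi_iff.2 fun k => measurable_pi_iff.2
        fun a => measurable_pi_iff.2 fun b => ?_
      by_cases h : (j, k) = (i, 0)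
      · simp only [h, dif_pos]; exact measurable_const
      · simp only [h, dif_neg, not_false_eq_true]; exact measurable_pi_apply _
    have h2 : Measurable fun (y : {q : (ℕ × ℕ) × (Fin nr × Fin nt) | q.1 = (i, 0)} → ℂ)
        (a : Fin nr) (b : Fin nt) => y ⟨((i, 0), (a, b)), rfl⟩ :=
      measurable_pi_iff.2 fun a => measurable_pi_iff.2 fun b => measurable_pi_apply _
    convert h0.comp h1 h2 using 1
    swap
    · rfl
    ext ω j k a b : 5
    by_cases h : (j, k) = (i, 0)
    · simp only [mask, h, Function.comp, if_true, dif_pos]; rfl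
    · simp only [mask, h, Function.comp, if_false, dif_neg, not_false_eq_true]
  have hproj (j k : ℕ) : Measurable fun h : ℕ → ℕ → Channel nr nt => h j k :=
    (measurable_pi_apply k).comp (measurable_pi_apply j)
  have hu : Measurable fun h : ℕ → ℕ → Channel nr nt => N.combiner 0 (h 0 0) :=
    (hN.measurable_combiner 0).comp (hproj 0 0)
  have hp : Measurable fun h : ℕ → ℕ → Channel nr nt => N.precoder i (h i i) :=
    (hN.measurable_precoder i).comp (hproj i i)
  have hY : Measurable fun ω => mask fun j k => N.chan j k ω := hmask.comp hN.measurable_allChan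
  have hψ' : Measurable fun z : ℂ => ψ (‖z‖ ^ 2) := hψ.comp (measurable_norm.pow_const 2)
  have hrow : iIndepFun (fun (q : Fin nr × Fin nt) ω => N.chan i 0 ω q.1 q.2) P :=
    hN.indep_chan.precomp (g := fun q : Fin nr × Fin nt => ((i, 0), q))
      fun _ _ h => (Prod.ext_iff.1 h).2
  have key := lintegral_mul_comp_inner_channelMap hY (hN.measurable_chan i 0) hind
    (hN.law_chan i 0) hrow hu hp (fun h => (hN.singular 0 _).1) (fun h => (hN.singular i _).2.1)
    hΦ hψ'
  have hΦm (ω : Ω) : Φ (mask fun j k => N.chan j k ω) = Φ fun j k => N.chan j k ω :=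
    hΦi _ _ fun j k h => by simp only [mask, h, if_false]
  have h00 (h : ℕ → ℕ → Channel nr nt) : mask h 0 0 = h 0 0 := by
    simp [mask, Prod.ext_iff, hi.symm]
  have hii (h : ℕ → ℕ → Channel nr nt) : mask h i i = h i i := by
    simp [mask, hi]
  simp only [hΦm, h00, hii] at key
  exact key

lemma lintegral_gain (hN : N.IsEigenbeamforming P lam) {i : ℕ} (hi : i ≠ 0) :
    ∫⁻ ω, ENNReal.ofReal (N.gain i ω) ∂P = 1 := by
  have := hN.lintegral_mul_comp_gain hi (Φ := fun _ => 1) measurable_const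
    (fun _ _ _ => rfl) (ψ := ENNReal.ofReal) ENNReal.measurable_ofReal
  simpa only [one_mul, lintegral_const, measure_univ, mul_one,
    lintegral_norm_sq_stdComplexGaussian] using this

/-- The interferers are integrated out one at a time. The channel `(i, 0)` enters no gain other than
that of `i`, because precoders depend on the diagonal channels `(j, j)`, so each step splits off one
factor `(1 + t)⁻¹`. -/
lemma lintegral_gain_zero_mul_exp (hN : N.IsEigenbeamforming P lam) {S : Finset ℕ} (hS : 0 ∉ S)
    {t : ℝ} (ht : 0 ≤ t) :
    ∫⁻ ω, ENNReal.ofReal (N.gain 0 ω) * ENNReal.ofReal (Real.exp (-(t * ∑ i ∈ S, N.gain i ω))) ∂P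
      = (∫⁻ ω, ENNReal.ofReal (N.gain 0 ω) ∂P) * ENNReal.ofReal ((1 + t)⁻¹) ^ S.card := by
  classical
  induction S using Finset.induction_on with
  | empty => simp
  | insert i S hiS ih =>
    have hi : i ≠ 0 := fun h => hS (h ▸ Finset.mem_insert_self _ _)
    have h0S : 0 ∉ S := fun h => hS (Finset.mem_insert_of_mem h)
    have key := hN.lintegral_mul_comp_gain hi
      (Φ := fun h => ENNReal.ofReal (N.gainOf 0 h) *
        ENNReal.ofReal (Real.exp (-(t * ∑ j ∈ S, N.gainOf j h))))
      ((hN.measurable_gainOf 0).ennreal_ofReal.mul (Measurable.ennreal_ofReal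
        (Real.measurable_exp.comp ((Finset.measurable_sum _ fun j _ =>
          hN.measurable_gainOf j).const_mul t).neg)))
      (fun h h' hh => by
        have h00 : h 0 0 = h' 0 0 := hh 0 0 (by simp [hi.symm])
        have hj (j) (hj : j ∈ insert 0 S) : N.gainOf j h = N.gainOf j h' := by
          have hji : j ≠ i := by
            rintro rfl
            rcases Finset.mem_insert.1 hj with h | h
            exacts [hi h, hiS h]
          rw [gainOf, gainOf, h00, hh j 0 (by simp [hji]), hh j j (by simp [hji])]
        have hsum : ∑ j ∈ S, N.gainOf j h = ∑ j ∈ S, N.gainOf j h' :=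
          Finset.sum_congr rfl fun j hjS => hj j (Finset.mem_insert_of_mem hjS)
        simp only [hj 0 (Finset.mem_insert_self _ _), hsum])
      (ψ := fun x => ENNReal.ofReal (Real.exp (-(t * x)))) (by fun_prop)
    rw [lintegral_exp_stdComplexGaussian ht] at key
    rw [Finset.card_insert_of_notMem hiS, pow_succ, ← mul_assoc, ← ih h0S]
    refine Eq.trans (lintegral_congr fun ω => ?_) key
    rw [Finset.sum_insert hiS, mul_assoc, ← ENNReal.ofReal_mul (Real.exp_pos _).le,
      ← Real.exp_add]
    simp only [← gain_eq_gainOf]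
    ring_nf

lemma lintegral_gain_zero_le (hN : N.IsEigenbeamforming P lam) :
    ∫⁻ ω, ENNReal.ofReal (N.gain 0 ω) ∂P ≤ ENNReal.ofReal (nt * nr) := by
  calc ∫⁻ ω, ENNReal.ofReal (N.gain 0 ω) ∂P
      ≤ ∫⁻ ω, ∑ q : Fin nr × Fin nt, ENNReal.ofReal (‖N.chan 0 0 ω q.1 q.2‖ ^ 2) ∂P := by
        refine lintegral_mono fun ω => ?_
        rw [← ENNReal.ofReal_sum_of_nonneg fun _ _ => by positivity]
        exact ENNReal.ofReal_le_ofReal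
          (norm_inner_channelMap_sq_le _ (hN.singular 0 _).1 (hN.singular 0 _).2.1)
    _ = ∑ q : Fin nr × Fin nt, 1 := by
        rw [lintegral_finsetSum _ fun q _ => ((hN.measurable_entry 0 0 q.1 q.2).norm.pow_const 2).ennreal_ofReal]
        refine Finset.sum_congr rfl fun q _ => ?_
        rw [← lintegral_norm_sq_stdComplexGaussian, ← hN.law_chan 0 0 q.1 q.2,
          lintegral_map (by fun_prop) (hN.measurable_entry 0 0 q.1 q.2)]
    _ = _ := by
        rw [Finset.sum_const, Finset.card_univ, Fintype.card_prod, Fintype.card_fin,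
          Fintype.card_fin, nsmul_one, mul_comm, ← Nat.cast_mul, ENNReal.ofReal_natCast]

/-- A zero-dimensional space contains no unit vector. -/
lemma nr_pos (hN : N.IsEigenbeamforming P lam) : 0 < nr := by
  rcases Nat.eq_zero_or_pos nr with rfl | h
  · have := (hN.singular 0 0).1
    rw [Subsingleton.elim (N.combiner 0 0) 0, norm_zero] at this
    exact absurd this zero_ne_one
  · exact h

/-- Chernoff bound. The gain dominates the squared norm of the first row, a sum of `nt` independent
exponential variables each satisfying `E[exp (-X)] = 1/2`; the bound is useful because `exp (1/2) <
2`. -/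
lemma measure_gain_zero_lt_le (hN : N.IsEigenbeamforming P lam) :
    P {ω | N.gain 0 ω < nt / 2} ≤ ENNReal.ofReal ((Real.exp (1 / 2) / 2) ^ nt) := by
  set X : Fin nt → Ω → ℝ≥0∞ := fun b ω =>
    ENNReal.ofReal (Real.exp (-(1 * ‖N.chan 0 0 ω ⟨0, hN.nr_pos⟩ b‖ ^ 2)))
  have hX (b : Fin nt) : Measurable (X b) := by
    have := hN.measurable_entry 0 0 ⟨0, hN.nr_pos⟩ b
    fun_prop
  have hXind : iIndepFun X P :=
    (hN.indep_chan.precomp (g := fun b : Fin nt => (((0, 0), (⟨0, hN.nr_pos⟩, b)) :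
      (ℕ × ℕ) × (Fin nr × Fin nt))) fun _ _ h => by simpa using h).comp
        (fun _ z => ENNReal.ofReal (Real.exp (-(1 * ‖z‖ ^ 2)))) fun _ => by fun_prop
  have hE (b : Fin nt) : ∫⁻ ω, X b ω ∂P = ENNReal.ofReal (1 / 2) := by
    rw [show (1 / 2 : ℝ) = (1 + 1)⁻¹ by norm_num, ← lintegral_exp_stdComplexGaussian zero_le_one,
      ← hN.law_chan 0 0 ⟨0, hN.nr_pos⟩ b, lintegral_map (by fun_prop) (hN.measurable_entry 0 0 _ b)]
  calc P {ω | N.gain 0 ω < nt / 2}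
      ≤ P {ω | ENNReal.ofReal (Real.exp (-(nt / 2))) ≤ ∏ b, X b ω} := by
        refine measure_mono fun ω (hω : N.gain 0 ω < nt / 2) => ?_
        have h1 := row_le_maxSingularValue_sq (N.chan 0 0 ω) ⟨0, hN.nr_pos⟩
        have h2 : N.gain 0 ω = _ := (hN.singular 0 (N.chan 0 0 ω)).norm_inner_sq
        rw [Set.mem_ofPred_eq, ← ENNReal.ofReal_prod_of_nonneg fun _ _ => (Real.exp_pos _).le,
          ← Real.exp_sum]
        refine ENNReal.ofReal_le_ofReal (Real.exp_le_exp.2 ?_)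
        simp only [one_mul, Finset.sum_neg_distrib]
        linarith
    _ ≤ (∫⁻ ω, ∏ b, X b ω ∂P) / ENNReal.ofReal (Real.exp (-(nt / 2))) :=
        meas_ge_le_lintegral_div (Finset.measurable_fun_prod _ fun b _ => hX b).aemeasurable
          (by simp [Real.exp_pos]) ENNReal.ofReal_ne_top
    _ = _ := by
        rw [lintegral_prod_eq_prod_lintegral_of_indepFun _ _ hXind hX]
        simp_rw [hE]
        rw [Finset.prod_const, Finset.card_univ, Fintype.card_fin,
          ← ENNReal.ofReal_pow (by norm_num), ← ENNReal.ofReal_div_of_pos (Real.exp_pos _)]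
        congr 1
        rw [Real.exp_neg, div_inv_eq_mul, div_eq_mul_inv (Real.exp _), mul_pow, ← Real.exp_nat_mul]
        ring_nf

end IsEigenbeamforming

end Network

end Cellular

/-! ### Poisson processes: counting, Chernoff bound, Campbell's formula -/

namespace Cellular

lemma pointCount_eq_encard (x : ℕ → Plane) {B : Set Plane} (hB : MeasurableSet B) :
    pointCount x B = ({i | x i ∈ B} : Set ℕ).encard := by
  rw [pointCount, Measure.sum_apply _ hB, ← ENNReal.tsum_set_one,
    tsum_subtype {i | x i ∈ B} fun _ => (1 : ℝ≥0∞)]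
  refine tsum_congr fun i => ?_
  rw [Measure.dirac_apply' _ hB]
  rfl

lemma exists_finset_of_le_pointCount {x : ℕ → Plane} {B : Set Plane} (hB : MeasurableSet B) {k : ℕ}
    (hk : (k : ℝ≥0∞) ≤ pointCount x B) : ∃ S : Finset ℕ, S.card = k ∧ ∀ i ∈ S, x i ∈ B := by
  rw [pointCount_eq_encard x hB] at hk
  have hk' : (k : ℕ∞) ≤ ({i | x i ∈ B} : Set ℕ).encard := by
    rwa [← ENat.toENNReal_le, ENat.toENNReal_coe]
  obtain ⟨t, ht, htk⟩ := Set.exists_subset_encard_eq hk'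
  have hfin : t.Finite := Set.finite_of_encard_eq_coe htk
  refine ⟨hfin.toFinset, ?_, fun i hi => ht (hfin.mem_toFinset.1 hi)⟩
  rw [hfin.encard_eq_coe_toFinset_card] at htk
  exact_mod_cast htk

lemma lintegral_poissonMeasure (r : ℝ≥0) (f : ℕ → ℝ≥0∞) :
    ∫⁻ k, f k ∂poissonMeasure r
      = ∑' k : ℕ, ENNReal.ofReal (Real.exp (-r) * r ^ k / k.factorial) * f k := by
  rw [poissonMeasure, lintegral_sum_measure]
  simp [lintegral_smul_measure]

/-- The left side equals `exp (-r * (1 - exp (-1)))`, and `exp (-1) ≤ 1/2`. -/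
lemma lintegral_exp_neg_poissonMeasure_le (r : ℝ≥0) :
    ∫⁻ k : ℕ, ENNReal.ofReal (Real.exp (-k)) ∂poissonMeasure r
      ≤ ENNReal.ofReal (Real.exp (-(r / 2))) := by
  have hs : HasSum (fun k : ℕ => Real.exp (-r) * ((r * Real.exp (-1)) ^ k / k.factorial))
      (Real.exp (-r) * Real.exp (r * Real.exp (-1))) := by
    have := NormedSpace.expSeries_div_hasSum_exp ((r : ℝ) * Real.exp (-1))
    rw [← Real.exp_eq_exp_ℝ] at this
    exact this.mul_left _
  have he : Real.exp (-1) ≤ 1 / 2 := by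
    rw [Real.exp_neg, inv_le_comm₀ (Real.exp_pos 1) (by norm_num)]
    have := Real.add_one_le_exp 1
    norm_num at this ⊢
    exact this
  calc _ = ∑' k : ℕ, ENNReal.ofReal (Real.exp (-r) * ((r * Real.exp (-1)) ^ k / k.factorial)) := by
        rw [lintegral_poissonMeasure]
        refine tsum_congr fun k => ?_
        rw [← ENNReal.ofReal_mul (by positivity), mul_pow, ← Real.exp_nat_mul]
        ring_nf
    _ = ENNReal.ofReal (Real.exp (-r) * Real.exp (r * Real.exp (-1))) := by
        rw [← ENNReal.ofReal_tsum_of_nonneg (fun k => by positivity) hs.summable, hs.tsum_eq]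
    _ ≤ _ := by
        rw [← Real.exp_add]
        refine ENNReal.ofReal_le_ofReal (Real.exp_le_exp.2 ?_)
        nlinarith [r.coe_nonneg]

lemma lintegral_natCast_poissonMeasure (r : ℝ≥0) :
    ∫⁻ k : ℕ, (k : ℝ≥0∞) ∂poissonMeasure r = r := by
  rw [lintegral_poissonMeasure, tsum_eq_zero_add' ENNReal.summable]
  have h (k : ℕ) : ENNReal.ofReal (Real.exp (-r) * r ^ (k + 1) / (k + 1).factorial)
      * ((k + 1 : ℕ) : ℝ≥0∞)
      = r * ENNReal.ofReal (Real.exp (-r) * r ^ k / k.factorial) := by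
    rw [← ENNReal.ofReal_natCast, ← ENNReal.ofReal_coe_nnreal, ← ENNReal.ofReal_mul (by positivity),
      ← ENNReal.ofReal_mul (by positivity), Nat.factorial_succ]
    congr 1
    push_cast
    field_simp
    ring
  simp_rw [h]
  rw [ENNReal.tsum_mul_left, ← ENNReal.ofReal_tsum_of_nonneg (fun k => by positivity)
    (hasSum_one_poissonMeasure r).summable, (hasSum_one_poissonMeasure r).tsum_eq]
  simp

namespace IsPoissonProcess

variable {Ω : Type*} [MeasurableSpace Ω] {P : Measure Ω} {lam : ℝ} {X : ℕ → Ω → Plane}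

lemma measurable_pointCount (hX : IsPoissonProcess P lam X) {B : Set Plane}
    (hB : MeasurableSet B) : Measurable fun ω => pointCount (fun i => X i ω) B := by
  simp_rw [pointCount, Measure.sum_apply _ hB]
  exact Measurable.tsum fun i =>
    (Measure.measurable_coe hB).comp (Measure.measurable_dirac.comp (hX.measurable i))

/-- Chernoff bound for the number of points in a set. -/
lemma measure_pointCount_le (hX : IsPoissonProcess P lam X) {B : Set Plane}
    (hB : MeasurableSet B) (hB' : volume B ≠ ∞) (hlam : 0 ≤ lam) {m : ℝ} (hm : 0 ≤ m) :
    P {ω | pointCount (fun i => X i ω) B ≤ ENNReal.ofReal m}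
      ≤ ENNReal.ofReal (Real.exp (m - lam * (volume B).toReal / 2)) := by
  set r := (lam * (volume B).toReal).toNNReal
  have hr : (r : ℝ) = lam * (volume B).toReal := Real.coe_toNNReal _ (by positivity)
  have hcast : Measurable fun k : ℕ => (k : ℝ≥0∞) := measurable_from_nat
  calc P {ω | pointCount (fun i => X i ω) B ≤ ENNReal.ofReal m}
      = P.map (fun ω => pointCount (fun i => X i ω) B) (Set.Iic (ENNReal.ofReal m)) := by
        rw [Measure.map_apply (hX.measurable_pointCount hB) measurableSet_Iic]; rfl
    _ = poissonMeasure r {k : ℕ | (k : ℝ≥0∞) ≤ ENNReal.ofReal m} := by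
        rw [hX.poisson B hB hB', Measure.map_apply hcast measurableSet_Iic]; rfl
    _ ≤ poissonMeasure r
          {k : ℕ | ENNReal.ofReal (Real.exp (-m)) ≤ ENNReal.ofReal (Real.exp (-k))} := by
        refine measure_mono fun k (hk : (k : ℝ≥0∞) ≤ ENNReal.ofReal m) => ?_
        rw [← ENNReal.ofReal_natCast, ENNReal.ofReal_le_ofReal_iff hm] at hk
        exact ENNReal.ofReal_le_ofReal (Real.exp_le_exp.2 (by linarith))
    _ ≤ (∫⁻ k : ℕ, ENNReal.ofReal (Real.exp (-k)) ∂poissonMeasure r)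
          / ENNReal.ofReal (Real.exp (-m)) :=
        meas_ge_le_lintegral_div measurable_from_nat.aemeasurable (by simp [Real.exp_pos])
          ENNReal.ofReal_ne_top
    _ ≤ ENNReal.ofReal (Real.exp (-(r / 2))) / ENNReal.ofReal (Real.exp (-m)) := by
        gcongr
        exact lintegral_exp_neg_poissonMeasure_le r
    _ = _ := by
        rw [← ENNReal.ofReal_div_of_pos (Real.exp_pos _), ← Real.exp_sub, hr]
        ring_nf

/-- The intensity measure of a Poisson process. -/
lemma sum_map_eq (hX : IsPoissonProcess P lam X) (hlam : 0 ≤ lam) :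
    Measure.sum (fun i => P.map (X i)) = ENNReal.ofReal lam • volume := by
  have key (B : Set Plane) (hB : MeasurableSet B) (hB' : volume B ≠ ∞) :
      Measure.sum (fun i => P.map (X i)) B = ENNReal.ofReal lam * volume B := by
    have h1 : Measure.sum (fun i => P.map (X i)) B
        = ∫⁻ ω, pointCount (fun i => X i ω) B ∂P := by
      have hm (i : ℕ) : Measurable fun ω => Measure.dirac (X i ω) B :=
        (Measure.measurable_coe hB).comp (Measure.measurable_dirac.comp (hX.measurable i))
      simp_rw [pointCount, Measure.sum_apply _ hB]
      rw [lintegral_tsum fun i => (hm i).aemeasurable]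
      refine tsum_congr fun i => ?_
      simp_rw [Measure.dirac_apply' _ hB]
      rw [← lintegral_map (measurable_one.indicator hB) (hX.measurable i),
        lintegral_indicator_one hB]
    have h2 : ∫⁻ ω, pointCount (fun i => X i ω) B ∂P
        = ∫⁻ z, z ∂P.map (fun ω => pointCount (fun i => X i ω) B) :=
      (lintegral_map measurable_id (hX.measurable_pointCount hB)).symm
    rw [h1, h2, hX.poisson B hB hB', lintegral_map (f := fun z => z) measurable_id measurable_from_nat,
      lintegral_natCast_poissonMeasure, ← ENNReal.ofReal, ENNReal.ofReal_mul hlam,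
      ENNReal.ofReal_toReal hB']
  -- The Poisson law concerns sets of finite volume only, so the measures are compared on an
  -- exhaustion by balls.
  refine (Measure.ext_iff_of_iUnion_eq_univ (s := fun n : ℕ => Metric.ball (0 : Plane) n)
    (Metric.iUnion_ball_nat 0)).2 fun n => Measure.ext fun B hB => ?_
  rw [Measure.restrict_apply hB, Measure.restrict_apply hB, Measure.smul_apply, smul_eq_mul,
    key _ (hB.inter measurableSet_ball)]
  exact ((measure_mono Set.inter_subset_right).trans_lt Metric.isBounded_ball.measure_lt_top).ne

/-- Campbell's formula. -/
lemma tsum_lintegral_comp (hX : IsPoissonProcess P lam X) (hlam : 0 ≤ lam) {g : Plane → ℝ≥0∞}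
    (hg : Measurable g) :
    ∑' i, ∫⁻ ω, g (X i ω) ∂P = ENNReal.ofReal lam * ∫⁻ x, g x := by
  rw [← smul_eq_mul, ← lintegral_smul_measure, ← hX.sum_map_eq hlam, lintegral_sum_measure]
  exact tsum_congr fun i => (lintegral_map hg (hX.measurable i)).symm

end IsPoissonProcess

/-! ### Finiteness of the interference -/

lemma PhysicallyFeasible.lintegral_lt_top {L : ℝ → ℝ} (hL : PhysicallyFeasible L) :
    ∫⁻ x : Plane, ENNReal.ofReal (L ‖x‖) < ∞ := by
  have h : Integrable fun x : Plane => L ‖x‖ := by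
    -- Polar coordinates: in dimension two the radial weight is `r`.
    rw [integrable_fun_norm_addHaar]
    simpa using hL.integrable
  refine lt_of_le_of_lt (lintegral_mono fun x => ?_) h.2
  rw [← ofReal_norm]
  exact ENNReal.ofReal_le_ofReal (Real.le_norm_self _)

namespace Network

variable {Ω : Type*} {nt nr : ℕ}

/-- The interference power at the tagged user, as an extended nonnegative number. -/
noncomputable def interference (N : Network Ω nt nr) (L : ℝ → ℝ) (ω : Ω) : ℝ≥0∞ :=
  ∑' i, ENNReal.ofReal (N.power L (i + 1) ω)

lemma power_nonneg {L : ℝ → ℝ} (hL : PhysicallyFeasible L) (N : Network Ω nt nr) (i : ℕ) (ω : Ω) :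
    0 ≤ N.power L i ω :=
  mul_nonneg (hL.nonneg _ (norm_nonneg _)) (N.gain_nonneg i ω)

lemma tsum_power_eq_toReal {L : ℝ → ℝ} (hL : PhysicallyFeasible L) (N : Network Ω nt nr) (ω : Ω) :
    ∑' i, N.power L (i + 1) ω = (N.interference L ω).toReal := by
  rw [interference, ENNReal.tsum_toReal_eq fun _ => ENNReal.ofReal_ne_top]
  exact tsum_congr fun i => (ENNReal.toReal_ofReal (N.power_nonneg hL _ _)).symm

lemma summable_power_of_interference_ne_top {L : ℝ → ℝ} (hL : PhysicallyFeasible L)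
    {N : Network Ω nt nr} {ω : Ω} (h : N.interference L ω ≠ ∞) :
    Summable fun i => N.power L (i + 1) ω := by
  refine (ENNReal.summable_toReal h).congr fun i => ?_
  rw [ENNReal.toReal_ofReal (N.power_nonneg hL _ _)]

namespace IsEigenbeamforming

set_option linter.unusedSectionVars false

variable [MeasurableSpace Ω] {P : Measure Ω} [IsProbabilityMeasure P] {N : Network Ω nt nr} {lam : ℝ} {L : ℝ → ℝ}

lemma measurable_power (hN : N.IsEigenbeamforming P lam) (hL : PhysicallyFeasible L)
    (i : ℕ) : Measurable (N.power L i) :=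
  (hL.measurable.comp (hN.poisson.measurable i).norm).mul (hN.measurable_gain i)

lemma measurable_interference (hN : N.IsEigenbeamforming P lam) (hL : PhysicallyFeasible L) :
    Measurable (N.interference L) :=
  Measurable.tsum fun i => (hN.measurable_power hL (i + 1)).ennreal_ofReal

lemma indepFun_bs_gain (hN : N.IsEigenbeamforming P lam) :
    IndepFun (fun ω i => N.bs i ω) (fun ω i => N.gain i ω) P :=
  hN.indep_bs_chan.comp measurable_id (measurable_pi_iff.2 hN.measurable_gainOf)

lemma lintegral_interference_le (hN : N.IsEigenbeamforming P lam)
    (hL : PhysicallyFeasible L) (hlam : 0 ≤ lam) :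
    ∫⁻ ω, N.interference L ω ∂P
      ≤ ENNReal.ofReal lam * ∫⁻ x : Plane, ENNReal.ofReal (L ‖x‖) := by
  have hLm : Measurable fun x : Plane => ENNReal.ofReal (L ‖x‖) :=
    (hL.measurable.comp measurable_norm).ennreal_ofReal
  have hi (i : ℕ) : ∫⁻ ω, ENNReal.ofReal (N.power L (i + 1) ω) ∂P
      = ∫⁻ ω, ENNReal.ofReal (L ‖N.bs (i + 1) ω‖) ∂P := by
    have hind : IndepFun (fun ω => ENNReal.ofReal (L ‖N.bs (i + 1) ω‖))
        (fun ω => ENNReal.ofReal (N.gain (i + 1) ω)) P :=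
      hN.indepFun_bs_gain.comp (φ := fun x : ℕ → Plane => ENNReal.ofReal (L ‖x (i + 1)‖))
        (ψ := fun g : ℕ → ℝ => ENNReal.ofReal (g (i + 1))) (hLm.comp (measurable_pi_apply (i + 1)))
        (ENNReal.measurable_ofReal.comp (measurable_pi_apply (i + 1)))
    have hm : Measurable fun ω => ENNReal.ofReal (L ‖N.bs (i + 1) ω‖) :=
      hLm.comp (hN.poisson.measurable (i + 1))
    simp_rw [power, ENNReal.ofReal_mul (hL.nonneg _ (norm_nonneg _))]
    rw [lintegral_mul_eq_lintegral_mul_lintegral_of_indepFun'' hm.aemeasurable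
      (hN.measurable_gain _).ennreal_ofReal.aemeasurable hind,
      hN.lintegral_gain (Nat.succ_ne_zero i), mul_one]
  simp_rw [interference]
  rw [lintegral_tsum fun i => (hN.measurable_power hL (i + 1)).ennreal_ofReal.aemeasurable]
  simp_rw [hi]
  rw [← hN.poisson.tsum_lintegral_comp hlam hLm]
  -- Adding the serving station back gives the full sum required by Campbell's formula.
  exact ENNReal.tsum_comp_le_tsum_of_injective (add_left_injective 1)
    fun i => ∫⁻ ω, ENNReal.ofReal (L ‖N.bs i ω‖) ∂P

lemma interference_ae_lt_top (hN : N.IsEigenbeamforming P lam)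
    (hL : PhysicallyFeasible L) (hlam : 0 ≤ lam) : ∀ᵐ ω ∂P, N.interference L ω < ∞ :=
  ae_lt_top (hN.measurable_interference hL) ((hN.lintegral_interference_le hL hlam).trans_lt
    (ENNReal.mul_lt_top ENNReal.ofReal_lt_top hL.lintegral_lt_top)).ne

end IsEigenbeamforming

end Network

end Cellular

/-! ### Lower bounds for the path loss function -/

namespace Cellular

lemma PhysicallyFeasible.zero_pos {L : ℝ → ℝ} (hL : PhysicallyFeasible L) : 0 < L 0 := by
  by_contra! h
  refine hL.integral_pos.ne' (setIntegral_eq_zero_of_forall_eq_zero fun r hr => ?_)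
  rw [le_antisymm ((hL.le_zero r (le_of_lt hr)).trans h) (hL.nonneg r (le_of_lt hr)), mul_zero]

lemma PhysicallyFeasible.exists_half_le {L : ℝ → ℝ} (hL : PhysicallyFeasible L)
    (hL0 : ContinuousWithinAt L (Set.Ici 0) 0) :
    ∃ ε > 0, ∀ r, 0 ≤ r → r ≤ ε → L 0 / 2 ≤ L r := by
  have h : ∀ᶠ r in 𝓝[Set.Ici 0] (0 : ℝ), L 0 / 2 < L r :=
    hL0.eventually (lt_mem_nhds (half_lt_self hL.zero_pos))
  obtain ⟨ε, hε, hball⟩ := Metric.mem_nhdsWithin_iff.1 h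
  refine ⟨ε / 2, half_pos hε, fun r h0 h1 => le_of_lt (hball ⟨?_, h0⟩)⟩
  rw [Metric.mem_ball, Real.dist_0_eq_abs, abs_of_nonneg h0]
  linarith

lemma lintegral_Ioc_ofReal {a b : ℝ} (ha : 0 ≤ a) (hab : a ≤ b) :
    ∫⁻ r in Set.Ioc a b, ENNReal.ofReal r = ENNReal.ofReal ((b ^ 2 - a ^ 2) / 2) := by
  rw [← integral_id, intervalIntegral.integral_of_le hab, ofReal_integral_eq_lintegral_ofReal]
  · exact (continuous_id.integrableOn_Icc).mono_set Set.Ioc_subset_Icc_self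
  · exact (ae_restrict_mem measurableSet_Ioc).mono fun r hr => ha.trans hr.1.le

/-- Outside some disc, the path loss function is bounded from below on discs whose areas grow
linearly by constants whose inverses grow at most exponentially. -/
lemma TailCondition.exists_lower_bounds {L : ℝ → ℝ} (hLt : TailCondition L) {ε : ℝ} (hε : 0 < ε) :
    ∃ (ρ lam₀ : ℝ) (a : ℕ → ℝ), ε ≤ ρ ∧ 0 < lam₀ ∧ (∀ k, 0 < a k) ∧ (∀ k, a k ≤ a 0) ∧
      (∀ (k : ℕ) (r : ℝ), ρ < r → r ≤ √(ρ ^ 2 + k) → a k ≤ L r) ∧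
      ∑' k : ℕ, ENNReal.ofReal ((a (k + 1))⁻¹ * Real.exp (-(Real.pi * lam₀ * k))) < ∞ := by
  obtain ⟨r₀, ζ, Lt, Lt', hr₀, -, hpos, hanti, -, hle, -, lamc, hlamc, hint⟩ := hLt
  have hintc := (hint (lamc + 1) (lt_add_one _)).2
  set ρ := max r₀ ε
  -- The radii have equally spaced squares, so consecutive circles enclose annuli of equal area and
  -- `r dr` has mass 1/2 between them.
  set t : ℕ → ℝ := fun k => √(ρ ^ 2 + k)
  have hρ : 0 < ρ := hε.trans_le (le_max_right _ _)
  have htsq (k : ℕ) : t k ^ 2 = ρ ^ 2 + k := Real.sq_sqrt (by positivity)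
  have ht : Monotone t := fun i j h => Real.sqrt_le_sqrt (by gcongr)
  have ht0 : t 0 = ρ := by simp [t, Real.sqrt_sq hρ.le]
  have hρt (k : ℕ) : ρ ≤ t k := ht0 ▸ ht (Nat.zero_le k)
  have hr₀ρ : r₀ ≤ ρ := le_max_left _ _
  have hmem {r : ℝ} (h : ρ ≤ r) : r ∈ Set.Ici r₀ := hr₀ρ.trans h
  set lam₀ := lamc + 1
  have hlam₀ : 0 < lam₀ := by positivity
  refine ⟨ρ, lam₀, fun k => Lt (t k), le_max_right _ _, hlam₀, fun k => hpos _ (hmem (hρt k)),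
    fun k => hanti (hmem (hρt 0)) (hmem (hρt k)) (ht (Nat.zero_le k)), fun k r h1 h2 => ?_, ?_⟩
  · exact (hanti (hmem h1.le) (hmem (hρt k)) h2).trans (hle r (hmem h1.le))
  set F : ℝ → ℝ := fun r => r / Lt r ^ 2 * Real.exp (-(Real.pi * lam₀ * r ^ 2))
  -- Of the two factors `(Lt r)⁻¹` in `F`, one is bounded below by `(Lt ρ)⁻¹` and goes into the
  -- constant; the other yields `(Lt (t (k + 1)))⁻¹`. The 1/2 is the integral of `r`, and the
  -- exponential comes from `r ^ 2 ≤ ρ ^ 2 + k + 2`.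
  set c := 1 / 2 * (Lt ρ)⁻¹ * Real.exp (-(Real.pi * lam₀ * (ρ ^ 2 + 2)))
  have hc : 0 < c := by
    have := hpos ρ (hmem le_rfl)
    positivity
  have hstep (k : ℕ) : ENNReal.ofReal c
      * ENNReal.ofReal ((Lt (t (k + 1)))⁻¹ * Real.exp (-(Real.pi * lam₀ * k)))
      ≤ ∫⁻ r in Set.Ioc (t (k + 1)) (t (k + 2)), ‖F r‖ₑ := by
    have hρpos := hpos ρ (hmem le_rfl)
    have hk := hpos _ (hmem (hρt (k + 1)))
    set b := (Lt ρ)⁻¹ * (Lt (t (k + 1)))⁻¹ * Real.exp (-(Real.pi * lam₀ * (ρ ^ 2 + (k + 2))))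
    calc _ = ENNReal.ofReal b * ∫⁻ r in Set.Ioc (t (k + 1)) (t (k + 2)), ENNReal.ofReal r := by
          rw [lintegral_Ioc_ofReal (hρ.le.trans (hρt _)) (ht (Nat.le_succ _)), htsq, htsq,
            ← ENNReal.ofReal_mul hc.le, ← ENNReal.ofReal_mul (by positivity)]
          congr 1
          have : Real.exp (-(Real.pi * lam₀ * (ρ ^ 2 + (k + 2))))
              = Real.exp (-(Real.pi * lam₀ * (ρ ^ 2 + 2))) * Real.exp (-(Real.pi * lam₀ * k)) := by
            rw [← Real.exp_add]
            ring_nf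
          simp only [b, c, this]
          push_cast
          ring
      _ = ∫⁻ r in Set.Ioc (t (k + 1)) (t (k + 2)), ENNReal.ofReal b * ENNReal.ofReal r :=
          (lintegral_const_mul _ ENNReal.measurable_ofReal).symm
      _ ≤ _ := by
          refine setLIntegral_mono' measurableSet_Ioc fun r hr => ?_
          have hρr : ρ ≤ r := (hρt _).trans hr.1.le
          have hr0 : 0 ≤ r := hρ.le.trans hρr
          have hLr := hpos r (hmem hρr)
          have h1 : Lt r ≤ Lt ρ := hanti (hmem le_rfl) (hmem hρr) hρr
          have h2 : Lt r ≤ Lt (t (k + 1)) := hanti (hmem (hρt _)) (hmem hρr) hr.1.le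
          have h3 : r ^ 2 ≤ ρ ^ 2 + (k + 2) := by
            have := htsq (k + 2)
            push_cast at this
            rw [← this]
            gcongr
            exact hr.2
          rw [← ENNReal.ofReal_mul (by positivity), ← ofReal_norm]
          refine ENNReal.ofReal_le_ofReal (le_trans ?_ (Real.le_norm_self _))
          calc b * r ≤ (Lt r)⁻¹ * (Lt r)⁻¹ * Real.exp (-(Real.pi * lam₀ * r ^ 2)) * r := by
                simp only [b]
                gcongr
            _ = F r := by
                simp only [F]
                field_simp
  have hsum : ENNReal.ofReal c * ∑' k : ℕ,
      ENNReal.ofReal ((Lt (t (k + 1)))⁻¹ * Real.exp (-(Real.pi * lam₀ * k))) < ∞ := by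
    rw [← ENNReal.tsum_mul_left]
    refine lt_of_le_of_lt (ENNReal.tsum_le_tsum hstep) (lt_of_le_of_lt ?_ hintc)
    rw [← lintegral_iUnion (fun k => measurableSet_Ioc)]
    · refine lintegral_mono_set (Set.iUnion_subset fun k r hr => ?_)
      exact (hr₀ρ.trans (hρt _)).trans_lt hr.1
    · exact (ht.comp fun i j h => Nat.succ_le_succ h : Monotone fun k => t (k + 1))
        |>.pairwise_disjoint_on_Ioc_succ
  refine lt_top_iff_ne_top.2 fun h => ?_
  rw [h, ENNReal.mul_top (ENNReal.ofReal_pos.2 hc).ne'] at hsum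
  exact lt_irrefl _ hsum

/-! ### Inverse moments of sums of gains -/

lemma inv_ofReal_eq_lintegral_exp {s : ℝ} (hs : 0 ≤ s) :
    (ENNReal.ofReal s)⁻¹ = ∫⁻ t in Set.Ioi (0 : ℝ), ENNReal.ofReal (Real.exp (-(t * s))) := by
  rcases hs.eq_or_lt with rfl | hs
  -- At `s = 0` both sides are infinite.
  · simp
  · have h := integrableOn_exp_mul_Ioi (neg_neg_iff_pos.2 hs) 0
    have h' := integral_exp_mul_Ioi (neg_neg_iff_pos.2 hs) 0
    simp_rw [show ∀ t, -(t * s) = -s * t by intro t; ring]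
    rw [← ofReal_integral_eq_lintegral_ofReal h (ae_of_all _ fun t => (Real.exp_pos _).le), h',
      ← ENNReal.ofReal_inv_of_pos hs]
    congr 1
    simp

lemma lintegral_Ioi_inv_one_add_pow {m : ℕ} (hm : 2 ≤ m) :
    ∫⁻ t in Set.Ioi (0 : ℝ), ENNReal.ofReal ((1 + t)⁻¹) ^ m = ENNReal.ofReal ((m - 1 : ℝ)⁻¹) := by
  have hm' : (-m : ℝ) < -1 := by
    have : (2 : ℝ) ≤ m := by exact_mod_cast hm
    linarith
  have e : Set.Ioi (0 : ℝ) = (fun t => 1 + t) ⁻¹' Set.Ioi 1 := by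
    ext t; simp
  calc _ = ∫⁻ t in Set.Ioi (0 : ℝ), ENNReal.ofReal ((1 + t) ^ (-m : ℝ)) := by
        refine setLIntegral_congr_fun measurableSet_Ioi fun t (ht : 0 < t) => ?_
        rw [← ENNReal.ofReal_pow (by positivity), Real.rpow_neg (by positivity),
          Real.rpow_natCast, inv_pow]
    _ = ∫⁻ t in Set.Ioi (1 : ℝ), ENNReal.ofReal (t ^ (-m : ℝ)) := by
        rw [e, (measurePreserving_add_left volume (1 : ℝ)).setLIntegral_comp_preimage
          (f := fun t => ENNReal.ofReal (t ^ (-m : ℝ))) measurableSet_Ioi (by fun_prop)]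
    _ = _ := by
        rw [← ofReal_integral_eq_lintegral_ofReal (integrableOn_Ioi_rpow_of_lt hm' one_pos)
          ((ae_restrict_mem measurableSet_Ioi).mono fun t ht =>
            Real.rpow_nonneg (zero_le_one.trans (le_of_lt ht)) _),
          integral_Ioi_rpow_of_lt hm' one_pos, Real.one_rpow]
        congr 1
        rw [show (-m + 1 : ℝ) = -(m - 1) by ring, neg_div_neg_eq, one_div]

namespace Network.IsEigenbeamforming

set_option linter.unusedSectionVars false

variable {Ω : Type*} {nt nr : ℕ} [MeasurableSpace Ω] {P : Measure Ω} [IsProbabilityMeasure P]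
  {N : Network Ω nt nr} {lam : ℝ} {L : ℝ → ℝ}

lemma nt_pos (hN : N.IsEigenbeamforming P lam) : 0 < nt := by
  rcases Nat.eq_zero_or_pos nt with rfl | h
  · have := (hN.singular 0 0).2.1
    rw [Subsingleton.elim (N.precoder 0 0) 0, norm_zero] at this
    exact absurd this zero_ne_one
  · exact h

/-- The reciprocal of the sum is a Laplace integral; after Tonelli the mean factorizes, leaving the
integral of `(1 + t) ^ (-S.card)`, which converges only for at least two interferers. -/
lemma lintegral_gain_zero_div_sum (hN : N.IsEigenbeamforming P lam) {S : Finset ℕ} (hS : 0 ∉ S)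
    (hcard : 2 ≤ S.card) :
    ∫⁻ ω, ENNReal.ofReal (N.gain 0 ω) / ENNReal.ofReal (∑ i ∈ S, N.gain i ω) ∂P
      ≤ ENNReal.ofReal (nt * nr) * ENNReal.ofReal ((S.card - 1 : ℝ)⁻¹) := by
  have hsm : Measurable fun ω => ∑ i ∈ S, N.gain i ω :=
    Finset.measurable_fun_sum _ fun i _ => hN.measurable_gain i
  have hG := (hN.measurable_gain 0).ennreal_ofReal
  have hm : Measurable fun z : Ω × ℝ => ENNReal.ofReal (N.gain 0 z.1)
      * ENNReal.ofReal (Real.exp (-(z.2 * ∑ i ∈ S, N.gain i z.1))) :=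
    (hG.comp measurable_fst).mul (Real.measurable_exp.comp
      (measurable_snd.mul (hsm.comp measurable_fst)).neg).ennreal_ofReal
  have hexp (ω : Ω) : Measurable fun t : ℝ =>
      ENNReal.ofReal (Real.exp (-(t * ∑ i ∈ S, N.gain i ω))) := by fun_prop
  calc _ = ∫⁻ ω, (∫⁻ t in Set.Ioi (0 : ℝ), ENNReal.ofReal (N.gain 0 ω)
        * ENNReal.ofReal (Real.exp (-(t * ∑ i ∈ S, N.gain i ω)))) ∂P := by
        refine lintegral_congr fun ω => ?_
        rw [lintegral_const_mul _ (hexp ω), ENNReal.div_eq_inv_mul, mul_comm,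
          inv_ofReal_eq_lintegral_exp (Finset.sum_nonneg fun i _ => N.gain_nonneg i ω)]
    _ = ∫⁻ t in Set.Ioi (0 : ℝ), ∫⁻ ω, ENNReal.ofReal (N.gain 0 ω)
        * ENNReal.ofReal (Real.exp (-(t * ∑ i ∈ S, N.gain i ω))) ∂P :=
        lintegral_lintegral_swap hm.aemeasurable
    _ = ∫⁻ t in Set.Ioi (0 : ℝ), (∫⁻ ω, ENNReal.ofReal (N.gain 0 ω) ∂P)
        * ENNReal.ofReal ((1 + t)⁻¹) ^ S.card :=
        setLIntegral_congr_fun measurableSet_Ioi fun t ht =>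
          hN.lintegral_gain_zero_mul_exp hS (le_of_lt ht)
    _ = (∫⁻ ω, ENNReal.ofReal (N.gain 0 ω) ∂P) * ENNReal.ofReal ((S.card - 1 : ℝ)⁻¹) := by
        rw [lintegral_const_mul _ (by fun_prop), lintegral_Ioi_inv_one_add_pow hcard]
    _ ≤ _ := by
        gcongr
        exact hN.lintegral_gain_zero_le

/-- For fixed positions `x` of the base stations, the ratio of the signal gain to the interference
is controlled by the interferers in a region where the path loss function is at least `w`. -/
lemma lintegral_gain_zero_div_tsum (hN : N.IsEigenbeamforming P lam)
    {x : ℕ → Plane} {B : Set Plane} (hB : MeasurableSet B) {w : ℝ} (hw : 0 < w)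
    (hLB : ∀ z ∈ B, w ≤ L ‖z‖) {k : ℕ} (hk : 2 ≤ k)
    (hxB : ((k + 1 : ℕ) : ℝ≥0∞) ≤ pointCount x B) :
    ∫⁻ ω, ENNReal.ofReal (N.gain 0 ω)
        / ∑' i, ENNReal.ofReal (L ‖x (i + 1)‖ * N.gain (i + 1) ω) ∂P
      ≤ ENNReal.ofReal (nt * nr) * ENNReal.ofReal ((w * (k - 1))⁻¹) := by
  obtain ⟨S', hS'card, hS'B⟩ := exists_finset_of_le_pointCount hB hxB
  -- One of the `k + 1` points in `B` may be the serving station; discarding it leaves at least `k`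
  -- interferers.
  obtain ⟨S, hSS', hScard⟩ : ∃ S ⊆ S'.erase 0, S.card = k := by
    refine Finset.exists_subset_card_eq ?_
    have := Finset.pred_card_le_card_erase (s := S') (a := 0)
    omega
  have h0S : 0 ∉ S := fun h => Finset.notMem_erase 0 S' (hSS' h)
  have hSB (i) (hi : i ∈ S) : x i ∈ B := hS'B i (Finset.mem_of_mem_erase (hSS' hi))
  have hle (ω : Ω) : ENNReal.ofReal w * ENNReal.ofReal (∑ i ∈ S, N.gain i ω)
      ≤ ∑' i, ENNReal.ofReal (L ‖x (i + 1)‖ * N.gain (i + 1) ω) := by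
    set g : ℕ → ℝ≥0∞ := fun i => if i = 0 then 0 else ENNReal.ofReal (L ‖x i‖ * N.gain i ω)
    calc _ = ∑ i ∈ S, ENNReal.ofReal (w * N.gain i ω) := by
          rw [← ENNReal.ofReal_mul hw.le, Finset.mul_sum, ENNReal.ofReal_sum_of_nonneg
            fun i _ => mul_nonneg hw.le (N.gain_nonneg i ω)]
      _ ≤ ∑ i ∈ S, g i := by
          refine Finset.sum_le_sum fun i hi => ?_
          have hi0 : i ≠ 0 := fun h => h0S (h ▸ hi)
          simp only [g, hi0, if_false]
          exact ENNReal.ofReal_le_ofReal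
            (mul_le_mul_of_nonneg_right (hLB _ (hSB i hi)) (N.gain_nonneg i ω))
      _ ≤ ∑' i, g i := ENNReal.sum_le_tsum _
      _ = ∑' i, g (i + 1) := by
          rw [tsum_eq_zero_add' ENNReal.summable]
          simp [g]
      _ = _ := by simp [g]
  have hG : Measurable fun ω => ENNReal.ofReal (N.gain 0 ω) / ENNReal.ofReal (∑ i ∈ S, N.gain i ω) :=
    (hN.measurable_gain 0).ennreal_ofReal.div
      (Finset.measurable_fun_sum _ fun i _ => hN.measurable_gain i).ennreal_ofReal
  have hw0 : ENNReal.ofReal w ≠ 0 := (ENNReal.ofReal_pos.2 hw).ne'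
  calc _ ≤ ∫⁻ ω, (ENNReal.ofReal w)⁻¹
        * (ENNReal.ofReal (N.gain 0 ω) / ENNReal.ofReal (∑ i ∈ S, N.gain i ω)) ∂P := by
        refine lintegral_mono fun ω => (ENNReal.div_le_div_left (hle ω) _).trans_eq ?_
        rw [div_eq_mul_inv, ENNReal.mul_inv (Or.inl hw0) (Or.inl ENNReal.ofReal_ne_top),
          div_eq_mul_inv, mul_left_comm]
    _ ≤ (ENNReal.ofReal w)⁻¹
        * (ENNReal.ofReal (nt * nr) * ENNReal.ofReal ((S.card - 1 : ℝ)⁻¹)) := by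
        rw [lintegral_const_mul _ hG]
        gcongr
        exact hN.lintegral_gain_zero_div_sum h0S (hScard ▸ hk)
    _ = _ := by
        rw [hScard, mul_inv, ENNReal.ofReal_mul (p := w⁻¹) (by positivity),
          ENNReal.ofReal_inv_of_pos hw,
          mul_left_comm]

/-- Conditioning the ratio of the signal gain to the interference on the positions. -/
lemma lintegral_gain_zero_div_interference (hN : N.IsEigenbeamforming P lam)
    (hL : PhysicallyFeasible L) :
    ∫⁻ ω, ENNReal.ofReal (N.gain 0 ω) / N.interference L ω ∂P
      = ∫⁻ ω, ∫⁻ ω', ENNReal.ofReal (N.gain 0 ω')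
          / ∑' i, ENNReal.ofReal (L ‖N.bs (i + 1) ω‖ * N.gain (i + 1) ω') ∂P ∂P := by
  set F : (ℕ → Plane) × (ℕ → ℝ) → ℝ≥0∞ := fun z =>
    ENNReal.ofReal (z.2 0) / ∑' i, ENNReal.ofReal (L ‖z.1 (i + 1)‖ * z.2 (i + 1))
  have hg (i : ℕ) : Measurable fun z : (ℕ → Plane) × (ℕ → ℝ) => z.2 i :=
    (measurable_pi_apply i).comp measurable_snd
  have hx (i : ℕ) : Measurable fun z : (ℕ → Plane) × (ℕ → ℝ) => L ‖z.1 i‖ :=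
    hL.measurable.comp ((measurable_pi_apply i).comp measurable_fst).norm
  have hF : Measurable F := (hg 0).ennreal_ofReal.div
    (Measurable.tsum fun i => ((hx (i + 1)).mul (hg (i + 1))).ennreal_ofReal)
  have hbs : Measurable fun ω i => N.bs i ω := measurable_pi_iff.2 hN.poisson.measurable
  have hgain : Measurable fun ω i => N.gain i ω := measurable_pi_iff.2 hN.measurable_gain
  have := Measure.isProbabilityMeasure_map (μ := P) hgain.aemeasurable
  calc _ = ∫⁻ ω, F ((fun i => N.bs i ω), (fun i => N.gain i ω)) ∂P := rfl
    _ = ∫⁻ z, F z ∂(P.map fun ω => ((fun i => N.bs i ω), (fun i => N.gain i ω))) :=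
        (lintegral_map hF (hbs.prodMk hgain)).symm
    _ = ∫⁻ x, ∫⁻ g, F (x, g) ∂(P.map fun ω i => N.gain i ω) ∂(P.map fun ω i => N.bs i ω) := by
        rw [hN.indepFun_bs_gain.map_prod_eq_prod_map_map hbs.aemeasurable hgain.aemeasurable,
          lintegral_prod _ hF.aemeasurable]
    _ = ∫⁻ ω, ∫⁻ g, F ((fun i => N.bs i ω), g) ∂(P.map fun ω i => N.gain i ω) ∂P :=
        lintegral_map hF.lintegral_prod_right' hbs
    _ = _ := by
        exact lintegral_congr fun ω => lintegral_map (hF.comp measurable_prodMk_left) hgain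

end Network.IsEigenbeamforming

end Cellular

/-! ### Mean ratio of signal gain to interference -/

namespace Cellular

/-- The annulus of area `π k` around the disc of radius `ρ`. -/
def annulus (ρ : ℝ) (k : ℕ) : Set Plane :=
  Metric.closedBall 0 (√(ρ ^ 2 + k)) \ Metric.closedBall 0 ρ

lemma measurableSet_annulus (ρ : ℝ) (k : ℕ) : MeasurableSet (annulus ρ k) :=
  measurableSet_closedBall.diff measurableSet_closedBall

lemma measurableSet_disc_union_annulus (ε ρ : ℝ) (k : ℕ) :
    MeasurableSet (Metric.closedBall (0 : Plane) ε ∪ annulus ρ k) :=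
  measurableSet_closedBall.union (measurableSet_annulus ρ k)

lemma annulus_zero {ρ : ℝ} (hρ : 0 ≤ ρ) : annulus ρ 0 = ∅ := by
  simp [annulus, Real.sqrt_sq hρ]

lemma volume_disc {r : ℝ} (hr : 0 ≤ r) :
    volume (Metric.closedBall (0 : Plane) r) = ENNReal.ofReal (Real.pi * r ^ 2) := by
  rw [EuclideanSpace.volume_closedBall_fin_two, ← ENNReal.ofReal_pow hr, mul_comm,
    ENNReal.ofReal_mul Real.pi_pos.le]

lemma volume_disc_union_annulus {ε ρ : ℝ} (hε : 0 ≤ ε) (hερ : ε ≤ ρ) (k : ℕ) :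
    volume (Metric.closedBall (0 : Plane) ε ∪ annulus ρ k)
      = ENNReal.ofReal (Real.pi * (ε ^ 2 + k)) := by
  have hρ : 0 ≤ ρ := hε.trans hερ
  have hsub : Metric.closedBall (0 : Plane) ρ ⊆ Metric.closedBall 0 (√(ρ ^ 2 + k)) :=
    Metric.closedBall_subset_closedBall (Real.le_sqrt_of_sq_le (by simp))
  have hdisj : Disjoint (Metric.closedBall (0 : Plane) ε) (annulus ρ k) :=
    Set.disjoint_left.2 fun z hz hz' => hz'.2 (Metric.closedBall_subset_closedBall hερ hz)
  rw [measure_union hdisj (measurableSet_annulus ρ k), annulus,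
    measure_sdiff hsub measurableSet_closedBall.nullMeasurableSet (by rw [volume_disc hρ]; simp),
    volume_disc hε, volume_disc hρ, volume_disc (Real.sqrt_nonneg _), Real.sq_sqrt (by positivity),
    ← ENNReal.ofReal_sub _ (by positivity), ← ENNReal.ofReal_add (by positivity)]
  · congr 1
    ring
  · have : Real.pi * (ρ ^ 2 + k) - Real.pi * ρ ^ 2 = Real.pi * k := by ring
    rw [this]
    positivity

namespace Network.IsEigenbeamforming

variable {Ω : Type*} {nt nr : ℕ} [MeasurableSpace Ω] {P : Measure Ω} [IsProbabilityMeasure P]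
  {N : Network Ω nt nr} {lam : ℝ} {L : ℝ → ℝ}

/-- A bound for fixed positions, in a form ready to be averaged. The first term covers a well-filled
disc. Term `k` of the series covers a sparse disc for which `k + 1` is the first annulus with three
points; then the disc and annulus `k` together hold at most `μ / 4 + 3` points. -/
lemma lintegral_gain_zero_div_tsum_le (hN : N.IsEigenbeamforming P lam) {ε w ρ μ : ℝ} (hw : 0 < w)
    (hLw : ∀ r, 0 ≤ r → r ≤ ε → w ≤ L r) (hρ : 0 ≤ ρ) {a : ℕ → ℝ} (ha : ∀ k, 0 < a k)
    (ha0 : ∀ k, a k ≤ a 0)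
    (hLa : ∀ (k : ℕ) (r : ℝ), ρ < r → r ≤ √(ρ ^ 2 + k) → a k ≤ L r) (hμ : 24 ≤ μ)
    (x : ℕ → Plane) :
    ∫⁻ ω, ENNReal.ofReal (N.gain 0 ω)
        / ∑' i, ENNReal.ofReal (L ‖x (i + 1)‖ * N.gain (i + 1) ω) ∂P
      ≤ ENNReal.ofReal (nt * nr) * (ENNReal.ofReal (8 / (w * μ))
        + ∑' k, ENNReal.ofReal (a (k + 1))⁻¹ * (Set.Iic (ENNReal.ofReal (μ / 4 + 3))).indicator 1
            (pointCount x (Metric.closedBall 0 ε ∪ annulus ρ k))) := by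
  set D : Set Plane := Metric.closedBall 0 ε
  have hD : MeasurableSet D := measurableSet_closedBall
  rcases lt_or_ge (ENNReal.ofReal (μ / 4)) (pointCount x D) with hbig | hsmall
  · have hfl : μ / 4 - 1 < ⌊μ / 4⌋₊ := Nat.sub_one_lt_floor _
    have h6 : 6 ≤ ⌊μ / 4⌋₊ := Nat.le_floor (by norm_num; linarith)
    -- One of the counted points is reserved for the serving station.
    obtain ⟨k, hk⟩ : ∃ k, ⌊μ / 4⌋₊ = k + 1 := ⟨⌊μ / 4⌋₊ - 1, by omega⟩
    have hk' : μ / 4 - 2 < k := by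
      rw [hk] at hfl
      push_cast at hfl
      linarith
    have hcount : ((k + 1 : ℕ) : ℝ≥0∞) ≤ pointCount x D := by
      refine le_trans ?_ hbig.le
      rw [← hk, ← ENNReal.ofReal_natCast]
      exact ENNReal.ofReal_le_ofReal (Nat.floor_le (by linarith))
    refine (hN.lintegral_gain_zero_div_tsum hD hw
      (fun z hz => hLw _ (norm_nonneg z) (mem_closedBall_zero_iff.1 hz)) (by omega) hcount).trans ?_
    gcongr
    refine le_trans (ENNReal.ofReal_le_ofReal ?_) le_self_add
    -- Here `k - 1 > μ / 4 - 3 ≥ μ / 8` because `μ ≥ 24`.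
    rw [inv_eq_one_div, div_le_div_iff₀ (mul_pos hw (by linarith)) (mul_pos hw (by linarith))]
    nlinarith
  have hunion (k : ℕ) (h3 : pointCount x (annulus ρ k) < 3) :
      pointCount x (D ∪ annulus ρ k) ∈ Set.Iic (ENNReal.ofReal (μ / 4 + 3)) := by
    rw [Set.mem_Iic, ENNReal.ofReal_add (by linarith) (by norm_num)]
    refine (measure_union_le _ _).trans (add_le_add hsmall (h3.le.trans ?_))
    simp
  by_cases h : ∃ k, 3 ≤ pointCount x (annulus ρ k)
  · classical
    -- The annulus of index zero is empty, so the first one with three points has a predecessor with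
    -- fewer than three.
    obtain ⟨k, hk⟩ : ∃ k, Nat.find h = k + 1 := by
      refine Nat.exists_eq_succ_of_ne_zero fun h0 => ?_
      have := Nat.find_spec h
      rw [h0, annulus_zero hρ] at this
      simp [pointCount] at this
    have hk3 : 3 ≤ pointCount x (annulus ρ (k + 1)) := hk ▸ Nat.find_spec h
    have hlt : pointCount x (annulus ρ k) < 3 :=
      not_le.1 (Nat.find_min h (by omega))
    refine (hN.lintegral_gain_zero_div_tsum (measurableSet_annulus ρ (k + 1)) (ha (k + 1))
      (fun z hz => hLa (k + 1) ‖z‖ ?_ ?_) le_rfl (by exact_mod_cast hk3)).trans ?_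
    · exact not_le.1 fun hz' => hz.2 (mem_closedBall_zero_iff.2 hz')
    · exact mem_closedBall_zero_iff.1 hz.1
    gcongr
    refine le_trans ?_ le_add_self
    refine le_trans (le_of_eq ?_) (ENNReal.le_tsum k)
    rw [Set.indicator_of_mem (hunion k hlt)]
    norm_num
  -- If no annulus holds three points, all indicators equal one and the series diverges, since its
  -- terms are at least `(a 0)⁻¹`; the bound is then trivial. The prefactor must be nonzero because
  -- `0 * ∞ = 0`.
  · push Not at h
    have htop : ∑' k, ENNReal.ofReal (a (k + 1))⁻¹ * (Set.Iic (ENNReal.ofReal (μ / 4 + 3))).indicator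
        1 (pointCount x (D ∪ annulus ρ k)) = ∞ := by
      refine top_le_iff.1 ?_
      calc (∞ : ℝ≥0∞) = ∑' _ : ℕ, ENNReal.ofReal (a 0)⁻¹ :=
            (ENNReal.tsum_const_eq_top_of_ne_zero (by simp [ha 0])).symm
        _ ≤ _ := by
            refine ENNReal.tsum_le_tsum fun k => ?_
            rw [Set.indicator_of_mem (hunion k (h k)), Pi.one_apply, mul_one]
            exact ENNReal.ofReal_le_ofReal (inv_anti₀ (ha _) (ha0 _))
    have hpos : ENNReal.ofReal (nt * nr) ≠ 0 := by
      have h1 : (0 : ℝ) < nt := Nat.cast_pos.2 hN.nt_pos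
      have h2 : (0 : ℝ) < nr := Nat.cast_pos.2 hN.nr_pos
      exact (ENNReal.ofReal_pos.2 (mul_pos h1 h2)).ne'
    rw [htop, add_top, ENNReal.mul_top hpos]
    exact le_top

end Network.IsEigenbeamforming

lemma IsPoissonProcess.measurable_indicator_Iic_pointCount {Ω : Type*} [MeasurableSpace Ω]
    {P : Measure Ω} {lam : ℝ} {X : ℕ → Ω → Plane} (hX : IsPoissonProcess P lam X) {B : Set Plane}
    (hB : MeasurableSet B) (c : ℝ≥0∞) :
    Measurable fun ω => (Set.Iic c).indicator (1 : ℝ≥0∞ → ℝ≥0∞)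
      (pointCount (fun i => X i ω) B) :=
  Measurable.comp (g := (Set.Iic c).indicator (1 : ℝ≥0∞ → ℝ≥0∞))
    (measurable_one.indicator measurableSet_Iic) (hX.measurable_pointCount hB)

/-- At large densities, the mean ratio of the signal gain to the interference is at most of the
order of the number of antenna pairs divided by the density. -/
theorem exists_lintegral_gain_zero_div_interference_le {Ω : Type*} [MeasurableSpace Ω]
    (P : Measure Ω) [IsProbabilityMeasure P] {L : ℝ → ℝ} (hL : PhysicallyFeasible L)
    (hL0 : ContinuousWithinAt L (Set.Ici 0) 0) (hLt : TailCondition L) :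
    ∃ C > 0, ∃ lam₁ > 0, ∀ lam ≥ lam₁, ∀ (nt nr : ℕ) (N : Network Ω nt nr),
      N.IsEigenbeamforming P lam →
      ∫⁻ ω, ENNReal.ofReal (N.gain 0 ω) / N.interference L ω ∂P
        ≤ ENNReal.ofReal (C * (nt * nr / lam)) := by
  obtain ⟨ε, hε, hLw⟩ := hL.exists_half_le hL0
  obtain ⟨ρ, lam₀, a, hερ, hlam₀, ha, ha0, hLa, hT⟩ := hLt.exists_lower_bounds hε
  set w := L 0 / 2
  have hw : 0 < w := half_pos hL.zero_pos
  set T := (∑' k : ℕ, ENNReal.ofReal ((a (k + 1))⁻¹ * Real.exp (-(Real.pi * lam₀ * k)))).toReal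
  have hT0 : 0 ≤ T := ENNReal.toReal_nonneg
  have hπ := Real.pi_pos
  set v := Real.pi * ε ^ 2
  have hv : 0 < v := by positivity
  -- The threshold `24 / v` ensures `μ ≥ 24`, and `2 * lam₀` compensates the factor 1/2 in the
  -- Poisson Chernoff exponent.
  refine ⟨(8 / w + 4 * Real.exp 3 * T) / v, by positivity, max (24 / v) (2 * lam₀),
    lt_max_of_lt_left (by positivity), fun lam hlam nt nr N hN => ?_⟩
  have hlam1 : 24 ≤ lam * v := (div_le_iff₀ hv).1 ((le_max_left _ _).trans hlam)
  have hlam2 : 2 * lam₀ ≤ lam := (le_max_right _ _).trans hlam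
  have hlam0 : 0 < lam := by linarith
  set μ := lam * v
  have hμ : 0 < μ := by positivity
  have hprob (k : ℕ) :
      ∫⁻ ω, (Set.Iic (ENNReal.ofReal (μ / 4 + 3))).indicator 1
          (pointCount (fun i => N.bs i ω) (Metric.closedBall 0 ε ∪ annulus ρ k)) ∂P
        ≤ ENNReal.ofReal (Real.exp 3 * Real.exp (-(μ / 4)) * Real.exp (-(Real.pi * lam₀ * k))) := by
    have hB := measurableSet_disc_union_annulus ε ρ k
    have hvol := volume_disc_union_annulus hε.le hερ k
    have hmeas := hN.poisson.measurable_pointCount hB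
    have h1 : ∫⁻ ω, (Set.Iic (ENNReal.ofReal (μ / 4 + 3))).indicator 1
          (pointCount (fun i => N.bs i ω) (Metric.closedBall 0 ε ∪ annulus ρ k)) ∂P
        = P {ω | pointCount (fun i => N.bs i ω) (Metric.closedBall 0 ε ∪ annulus ρ k)
          ≤ ENNReal.ofReal (μ / 4 + 3)} :=
      lintegral_indicator_one (measurableSet_le hmeas measurable_const)
    rw [h1]
    refine (hN.poisson.measure_pointCount_le hB (by rw [hvol]; exact ENNReal.ofReal_ne_top)
      hlam0.le (by positivity)).trans ?_
    rw [hvol, ENNReal.toReal_ofReal (by positivity), ← Real.exp_add, ← Real.exp_add]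
    refine ENNReal.ofReal_le_ofReal (Real.exp_le_exp.2 ?_)
    have hk : Real.pi * lam₀ * k ≤ lam * (Real.pi * k) / 2 := by
      have : 0 ≤ Real.pi * k := by positivity
      nlinarith
    simp only [μ, v]
    linarith
  -- Exponential decay is more than needed: order `1 / μ` puts the sparse-disc contribution on a par
  -- with the main term.
  have hexp : Real.exp (-(μ / 4)) ≤ 4 / μ := by
    rw [Real.exp_neg, inv_le_comm₀ (Real.exp_pos _) (by positivity), inv_div]
    linarith [Real.add_one_le_exp (μ / 4)]
  have hJ := hN.lintegral_gain_zero_div_tsum_le hw hLw (hε.le.trans hερ) ha ha0 hLa hlam1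
  have hm (k : ℕ) := hN.poisson.measurable_indicator_Iic_pointCount
    (measurableSet_disc_union_annulus ε ρ k) (ENNReal.ofReal (μ / 4 + 3))
  calc ∫⁻ ω, ENNReal.ofReal (N.gain 0 ω) / N.interference L ω ∂P
      ≤ ∫⁻ ω, ENNReal.ofReal (nt * nr) * (ENNReal.ofReal (8 / (w * μ))
        + ∑' k, ENNReal.ofReal (a (k + 1))⁻¹ * (Set.Iic (ENNReal.ofReal (μ / 4 + 3))).indicator 1
            (pointCount (fun i => N.bs i ω) (Metric.closedBall 0 ε ∪ annulus ρ k))) ∂P := by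
        rw [hN.lintegral_gain_zero_div_interference hL]
        exact lintegral_mono fun ω => hJ fun i => N.bs i ω
    _ = ENNReal.ofReal (nt * nr) * (ENNReal.ofReal (8 / (w * μ))
        + ∑' k, ENNReal.ofReal (a (k + 1))⁻¹ *
          ∫⁻ ω, (Set.Iic (ENNReal.ofReal (μ / 4 + 3))).indicator 1
            (pointCount (fun i => N.bs i ω) (Metric.closedBall 0 ε ∪ annulus ρ k)) ∂P) := by
        rw [lintegral_const_mul' _ _ ENNReal.ofReal_ne_top, lintegral_add_left measurable_const,
          lintegral_const, measure_univ, mul_one, lintegral_tsum fun k =>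
            ((hm k).const_mul _).aemeasurable]
        congr 3 with k
        rw [lintegral_const_mul _ (hm k)]
    _ ≤ ENNReal.ofReal (nt * nr) * (ENNReal.ofReal (8 / (w * μ))
        + ENNReal.ofReal (Real.exp 3 * (4 / μ)) * ENNReal.ofReal T) := by
        gcongr
        rw [ENNReal.ofReal_toReal hT.ne, ← ENNReal.tsum_mul_left]
        refine ENNReal.tsum_le_tsum fun k => ?_
        have hak := inv_nonneg.2 (ha (k + 1)).le
        rw [← ENNReal.ofReal_mul (by positivity)]
        refine (mul_le_mul_right (hprob k) _).trans ?_
        rw [← ENNReal.ofReal_mul hak]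
        refine ENNReal.ofReal_le_ofReal ?_
        calc _ = Real.exp 3 * Real.exp (-(μ / 4))
              * ((a (k + 1))⁻¹ * Real.exp (-(Real.pi * lam₀ * k))) := by ring
          _ ≤ _ := by gcongr
    _ = _ := by
        rw [← ENNReal.ofReal_mul (by positivity), ← ENNReal.ofReal_add (by positivity)
          (by positivity), ← ENNReal.ofReal_mul (by positivity)]
        congr 1
        simp only [μ]
        field_simp

end Cellular

/-! ### From gains and interference to averages of SINR and spectral efficiency -/

namespace Cellular

/-- Bernoulli's inequality `1 + C x ≤ (1 + x) ^ C`, after taking logarithms. -/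
lemma logb_one_add_mul_le {C x : ℝ} (hC : 1 ≤ C) (hx : 0 ≤ x) :
    Real.logb 2 (1 + C * x) ≤ C * Real.logb 2 (1 + x) := by
  rw [← Real.logb_rpow_eq_mul_logb_of_pos (by linarith)]
  exact Real.logb_le_logb_of_le one_lt_two (by positivity)
    (one_add_mul_self_le_rpow_one_add (by linarith) hC)

lemma mul_logb_one_add_le {c x : ℝ} (hc : 0 < c) (hc1 : c ≤ 1) (hx : 0 ≤ x) :
    c * Real.logb 2 (1 + x) ≤ Real.logb 2 (1 + c * x) := by
  have h := logb_one_add_mul_le ((one_le_inv₀ hc).2 hc1) (mul_nonneg hc.le hx)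
  rw [inv_mul_cancel_left₀ hc.ne'] at h
  rwa [← le_inv_mul_iff₀ hc]

/-- The tangent of the concave function `s ↦ log₂ (1 + s)` lies above its graph. -/
lemma logb_one_add_le_tangent {s m : ℝ} (hs : 0 ≤ s) (hm : 0 ≤ m) :
    Real.logb 2 (1 + s) ≤ Real.logb 2 (1 + m) + (s - m) / ((1 + m) * Real.log 2) := by
  have h := Real.log_le_sub_one_of_pos (x := (1 + s) / (1 + m)) (by positivity)
  rw [Real.log_div (by positivity) (by positivity)] at h
  have h2 : (1 + s) / (1 + m) - 1 = (s - m) / (1 + m) := by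
    field_simp
    ring
  have hlog : 0 < Real.log 2 := Real.log_pos one_lt_two
  rw [h2] at h
  rw [Real.logb, Real.logb, ← div_div, ← add_div]
  gcongr
  linarith

lemma isBigO_of_eventually_le {α : Type*} {l : Filter α} {f g : α → ℝ} {C : ℝ} (hC : 0 ≤ C)
    (h : ∀ᶠ x in l, 0 ≤ f x ∧ f x ≤ C * g x) : f =O[l] g := by
  refine IsBigO.of_bound C (h.mono fun x hx => ?_)
  rw [Real.norm_of_nonneg hx.1]
  exact hx.2.trans (mul_le_mul_of_nonneg_left (Real.le_norm_self _) hC)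

namespace Network

variable {Ω : Type*} {nt nr : ℕ}

lemma sinr_nonneg {L : ℝ → ℝ} (hL : PhysicallyFeasible L) {σ2 : ℝ} (hσ : 0 ≤ σ2)
    (N : Network Ω nt nr) (ω : Ω) : 0 ≤ N.sinr L σ2 ω :=
  div_nonneg (N.power_nonneg hL 0 ω) (add_nonneg (tsum_nonneg fun _ => N.power_nonneg hL _ ω)
    (mul_nonneg (sq_nonneg _) hσ))

namespace IsEigenbeamforming

set_option linter.unusedSectionVars false

variable [MeasurableSpace Ω] {P : Measure Ω} [IsProbabilityMeasure P]
  {N : Network Ω nt nr} {lam : ℝ} {L : ℝ → ℝ} {σ2 : ℝ}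

lemma sinr_eq (hN : N.IsEigenbeamforming P lam) (hL : PhysicallyFeasible L) (ω : Ω) :
    N.sinr L σ2 ω = N.power L 0 ω / ((N.interference L ω).toReal + σ2) := by
  rw [sinr, tsum_power_eq_toReal hL, combVec, (hN.singular 0 _).1, one_pow, one_mul]

lemma measurable_sinr (hN : N.IsEigenbeamforming P lam) (hL : PhysicallyFeasible L) :
    Measurable (N.sinr L σ2) := by
  rw [funext (hN.sinr_eq hL)]
  exact (hN.measurable_power hL 0).div ((hN.measurable_interference hL).ennreal_toReal.add_const _)

/-- Infinite interference must be excluded, since its `toReal` is zero. A vanishing denominator is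
harmless, since the real quotient is then zero. -/
lemma ofReal_sinr_le (hN : N.IsEigenbeamforming P lam) (hL : PhysicallyFeasible L) (hσ : 0 ≤ σ2)
    {ω : Ω} (hω : N.interference L ω ≠ ∞) :
    ENNReal.ofReal (N.sinr L σ2 ω)
      ≤ ENNReal.ofReal (L 0) * (ENNReal.ofReal (N.gain 0 ω) / N.interference L ω) := by
  rw [hN.sinr_eq hL]
  have hD0 : 0 ≤ (N.interference L ω).toReal + σ2 := by positivity
  rcases hD0.eq_or_lt with h | h
  · simp [← h]
  · rw [ENNReal.ofReal_div_of_pos h, ← mul_div_assoc, ← ENNReal.ofReal_mul hL.zero_pos.le]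
    refine ENNReal.div_le_div (ENNReal.ofReal_le_ofReal ?_) ?_
    · exact mul_le_mul_of_nonneg_right (hL.le_zero _ (norm_nonneg _)) (N.gain_nonneg 0 ω)
    · rw [ENNReal.le_ofReal_iff_toReal_le hω hD0]
      linarith

lemma integrable_sinr_of_le (hN : N.IsEigenbeamforming P lam) (hL : PhysicallyFeasible L)
    (hlam : 0 ≤ lam) (hσ : 0 ≤ σ2) {b : ℝ} (hb0 : 0 ≤ b)
    (hb : ∫⁻ ω, ENNReal.ofReal (N.gain 0 ω) / N.interference L ω ∂P ≤ ENNReal.ofReal b) :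
    Integrable (N.sinr L σ2) P ∧ N.avgSinr P L σ2 ≤ L 0 * b := by
  have h0 := N.sinr_nonneg hL hσ
  have hle : ∫⁻ ω, ENNReal.ofReal (N.sinr L σ2 ω) ∂P ≤ ENNReal.ofReal (L 0 * b) := by
    rw [ENNReal.ofReal_mul hL.zero_pos.le]
    refine le_trans (lintegral_mono_ae ((hN.interference_ae_lt_top hL hlam).mono fun ω hω =>
      hN.ofReal_sinr_le hL hσ hω.ne)) ?_
    rw [lintegral_const_mul' _ _ ENNReal.ofReal_ne_top]
    gcongr
  have hmeas := (hN.measurable_sinr (σ2 := σ2) hL).aestronglyMeasurable (μ := P)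
  refine ⟨⟨hmeas, ?_⟩, ?_⟩
  · rw [hasFiniteIntegral_iff_ofReal (ae_of_all _ h0)]
    exact hle.trans_lt ENNReal.ofReal_lt_top
  · rw [avgSinr, integral_eq_lintegral_of_nonneg_ae (ae_of_all _ h0) hmeas]
    exact ENNReal.toReal_le_of_le_ofReal (mul_nonneg hL.zero_pos.le hb0) hle

/-- If the mean of the ratio of signal gain and interference is finite, then the SINR is at least
of the order `nt / lam` unless the nearest base station is far, the signal gain is small, or the
interference is large. -/
lemma measure_sinr_lt_le (hN : N.IsEigenbeamforming P lam) (hL : PhysicallyFeasible L)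
    (hlam : 0 < lam) (hσ : 0 ≤ σ2) (hfin : ∫⁻ ω, ENNReal.ofReal (N.gain 0 ω) /
      N.interference L ω ∂P < ∞) {ε K : ℝ} (hε : 0 < ε)
    (hLε : ∀ r, 0 ≤ r → r ≤ ε → L 0 / 2 ≤ L r) (hK : 0 < K)
    (hLK : ∫⁻ x : Plane, ENNReal.ofReal (L ‖x‖) ≤ ENNReal.ofReal K) :
    P {ω | N.sinr L σ2 ω < L 0 / 2 * (nt / 2) / (4 * K * lam + σ2)}
      ≤ ENNReal.ofReal (Real.exp (-(lam * (Real.pi * ε ^ 2) / 2)))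
        + ENNReal.ofReal ((Real.exp (1 / 2) / 2) ^ nt) + ENNReal.ofReal (1 / 4) := by
  set E₁ := {ω | pointCount (fun i => N.bs i ω) (Metric.closedBall 0 ε) ≤ ENNReal.ofReal 0}
  set E₂ := {ω | N.gain 0 ω < nt / 2}
  set E₃ := {ω | ENNReal.ofReal (4 * K * lam) ≤ N.interference L ω}
  have h1 : P E₁ ≤ ENNReal.ofReal (Real.exp (-(lam * (Real.pi * ε ^ 2) / 2))) := by
    refine (hN.poisson.measure_pointCount_le measurableSet_closedBall
      (by rw [volume_disc hε.le]; exact ENNReal.ofReal_ne_top) hlam.le le_rfl).trans_eq ?_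
    rw [volume_disc hε.le, ENNReal.toReal_ofReal (by positivity), zero_sub]
  have h3 : P E₃ ≤ ENNReal.ofReal (1 / 4) := by
    refine (meas_ge_le_lintegral_div (hN.measurable_interference hL).aemeasurable
      (ENNReal.ofReal_pos.2 (by positivity)).ne' ENNReal.ofReal_ne_top).trans ?_
    refine (ENNReal.div_le_div_right ((hN.lintegral_interference_le hL hlam.le).trans
      (mul_le_mul_right hLK _)) _).trans_eq ?_
    rw [← ENNReal.ofReal_mul hlam.le, ← ENNReal.ofReal_div_of_pos (by positivity)]
    congr 1
    field_simp
  have hratio : ∀ᵐ ω ∂P, ENNReal.ofReal (N.gain 0 ω) / N.interference L ω < ∞ :=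
    ae_lt_top ((hN.measurable_gain 0).ennreal_ofReal.div (hN.measurable_interference hL)) hfin.ne
  have hsub : {ω | N.sinr L σ2 ω < L 0 / 2 * (nt / 2) / (4 * K * lam + σ2)}
      ≤ᵐ[P] (E₁ ∪ E₂ ∪ E₃ : Set Ω) := by
    filter_upwards [hratio, hN.poisson.ordered] with ω hω hord hs
    by_contra hbad
    have hbad' : ω ∉ E₁ ∪ E₂ ∪ E₃ := hbad
    simp only [Set.mem_union, not_or] at hbad'
    obtain ⟨⟨hb1, hb2⟩, hb3⟩ := hbad'
    replace hb2 : (nt : ℝ) / 2 ≤ N.gain 0 ω := not_lt.1 hb2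
    replace hb3 : N.interference L ω < ENNReal.ofReal (4 * K * lam) := not_le.1 hb3
    have hnt : (0 : ℝ) < nt := Nat.cast_pos.2 hN.nt_pos
    -- Vanishing interference without noise would make the SINR zero by the convention for division;
    -- finiteness of the ratio rules this out when the signal gain is positive.
    have hI0 : N.interference L ω ≠ 0 := fun h => by
      rw [h, ENNReal.div_zero (ENNReal.ofReal_pos.2 (by linarith)).ne'] at hω
      exact lt_irrefl _ hω
    have hIpos := ENNReal.toReal_pos hI0 hb3.ne_top
    have hIle : (N.interference L ω).toReal ≤ 4 * K * lam :=
      ENNReal.toReal_le_of_le_ofReal (by positivity) hb3.le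
    have hnear : ‖N.bs 0 ω‖ ≤ ε := by
      have hone : ((1 : ℕ) : ℝ≥0∞) ≤ pointCount (fun i => N.bs i ω) (Metric.closedBall 0 ε) := by
        have hne : pointCount (fun i => N.bs i ω) (Metric.closedBall 0 ε) ≠ 0 := fun h =>
          hb1 (h.le.trans zero_le)
        rw [pointCount_eq_encard _ measurableSet_closedBall] at hne ⊢
        rw [← ENat.toENNReal_coe, ENat.toENNReal_le]
        exact Order.one_le_iff_pos.2 (pos_iff_ne_zero.2 fun h => hne (by rw [h, ENat.toENNReal_zero]))
      obtain ⟨S, hS, hSB⟩ := exists_finset_of_le_pointCount measurableSet_closedBall hone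
      obtain ⟨i, hi⟩ := Finset.card_pos.1 (hS ▸ one_pos)
      exact (hord (Nat.zero_le i)).trans (mem_closedBall_zero_iff.1 (hSB i hi))
    refine not_le.2 hs ?_
    rw [hN.sinr_eq hL]
    refine div_le_div₀ (N.power_nonneg hL 0 ω) (mul_le_mul (hLε _ (norm_nonneg _) hnear) hb2
      (by positivity) (hL.nonneg _ (norm_nonneg _))) (by linarith) (by linarith)
  calc _ ≤ P (E₁ ∪ E₂ ∪ E₃) := measure_mono_ae hsub
    _ ≤ P E₁ + P E₂ + P E₃ :=
        (measure_union_le _ _).trans (add_le_add_left (measure_union_le _ _) _)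
    _ ≤ _ := add_le_add (add_le_add h1 hN.measure_gain_zero_lt_le) h3

lemma integrable_ase (hN : N.IsEigenbeamforming P lam) (hL : PhysicallyFeasible L) (hσ : 0 ≤ σ2)
    (hint : Integrable (N.sinr L σ2) P) : Integrable (N.ase L σ2 lam) P := by
  refine Integrable.const_mul ?_ lam
  have hm : Measurable fun ω => Real.logb 2 (1 + N.sinr L σ2 ω) :=
    (Real.measurable_log.comp ((hN.measurable_sinr hL).const_add 1)).div_const _
  refine (hint.div_const (Real.log 2)).mono' hm.aestronglyMeasurable (ae_of_all _ fun ω => ?_)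
  have h0 := N.sinr_nonneg hL hσ ω
  -- The tangent at zero bounds the logarithm by a multiple of the SINR.
  have h := logb_one_add_le_tangent h0 le_rfl
  rw [Real.norm_of_nonneg (Real.logb_nonneg one_lt_two (by linarith))]
  simpa using h

/-- Jensen's inequality. -/
lemma avgAse_le (hN : N.IsEigenbeamforming P lam) (hL : PhysicallyFeasible L) (hσ : 0 ≤ σ2)
    (hlam : 0 ≤ lam) (hint : Integrable (N.sinr L σ2) P) :
    N.avgAse P L σ2 lam ≤ lam * Real.logb 2 (1 + N.avgSinr P L σ2) := by
  set m := N.avgSinr P L σ2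
  have hm : 0 ≤ m := integral_nonneg (N.sinr_nonneg hL hσ)
  have hsub : Integrable (fun ω => (N.sinr L σ2 ω - m) / ((1 + m) * Real.log 2)) P :=
    (hint.sub (integrable_const m)).div_const _
  calc N.avgAse P L σ2 lam
      ≤ ∫ ω, lam * (Real.logb 2 (1 + m) + (N.sinr L σ2 ω - m) / ((1 + m) * Real.log 2)) ∂P :=
        integral_mono (hN.integrable_ase hL hσ hint) (((integrable_const _).add hsub).const_mul lam)
          fun ω => mul_le_mul_of_nonneg_left
            (logb_one_add_le_tangent (N.sinr_nonneg hL hσ ω) hm) hlam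
    _ = _ := by
        rw [integral_const_mul, integral_add (integrable_const _) hsub, integral_div,
          integral_sub hint (integrable_const m)]
        simp only [integral_const, probReal_univ, one_smul]
        rw [show ∫ ω, N.sinr L σ2 ω ∂P = m from rfl, sub_self, zero_div, add_zero]

/-- Markov's inequality for the SINR and for the area spectral efficiency. -/
lemma half_mul_le_average (hN : N.IsEigenbeamforming P lam) (hL : PhysicallyFeasible L)
    (hσ : 0 ≤ σ2) (hlam : 0 ≤ lam) (hint : Integrable (N.sinr L σ2) P) {s : ℝ} (hs : 0 ≤ s)
    (hP : P {ω | N.sinr L σ2 ω < s} ≤ ENNReal.ofReal (1 / 2)) :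
    1 / 2 * s ≤ N.avgSinr P L σ2 ∧
      1 / 2 * (lam * Real.logb 2 (1 + s)) ≤ N.avgAse P L σ2 lam := by
  have hreal : 1 / 2 ≤ P.real {ω | s ≤ N.sinr L σ2 ω} := by
    have hms : MeasurableSet {ω | N.sinr L σ2 ω < s} :=
      measurableSet_lt (hN.measurable_sinr hL) measurable_const
    have hc : {ω | s ≤ N.sinr L σ2 ω} = {ω | N.sinr L σ2 ω < s}ᶜ := by
      ext ω; simp
    have h2 : P.real {ω | N.sinr L σ2 ω < s} ≤ 1 / 2 :=
      ENNReal.toReal_le_of_le_ofReal (by norm_num) hP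
    rw [hc, probReal_compl_eq_one_sub hms]
    linarith
  have h0 := N.sinr_nonneg hL hσ
  have hv : 0 ≤ lam * Real.logb 2 (1 + s) :=
    mul_nonneg hlam (Real.logb_nonneg one_lt_two (by linarith))
  constructor
  · calc 1 / 2 * s ≤ s * P.real {ω | s ≤ N.sinr L σ2 ω} := by nlinarith
      _ ≤ _ := mul_meas_ge_le_integral_of_nonneg (ae_of_all _ h0) hint s
  · have hsub : P.real {ω | s ≤ N.sinr L σ2 ω}
        ≤ P.real {ω | lam * Real.logb 2 (1 + s) ≤ N.ase L σ2 lam ω} := by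
      refine measureReal_mono fun ω (hω : s ≤ N.sinr L σ2 ω) => ?_
      exact mul_le_mul_of_nonneg_left
        (Real.logb_le_logb_of_le one_lt_two (by linarith) (by linarith)) hlam
    calc 1 / 2 * (lam * Real.logb 2 (1 + s))
        ≤ lam * Real.logb 2 (1 + s) * P.real {ω | lam * Real.logb 2 (1 + s) ≤ N.ase L σ2 lam ω} := by
          nlinarith
      _ ≤ _ := mul_meas_ge_le_integral_of_nonneg (ae_of_all _ fun ω => mul_nonneg hlam
          (Real.logb_nonneg one_lt_two (by linarith [h0 ω]))) (hN.integrable_ase hL hσ hint) _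

end IsEigenbeamforming

end Network

/-- Scaling laws of networks with eigenbeamforming, with constants that depend neither on the
numbers of antennas nor on the density. -/
theorem exists_average_bounds {Ω : Type*} [MeasurableSpace Ω] (P : Measure Ω)
    [IsProbabilityMeasure P] {L : ℝ → ℝ} (hL : PhysicallyFeasible L)
    (hL0 : ContinuousWithinAt L (Set.Ici 0) 0) (hLt : TailCondition L) {σ2 : ℝ} (hσ : 0 ≤ σ2) :
    ∃ C > 0, ∃ lam₁ > 0, ∃ n₁ : ℕ, ∀ lam ≥ lam₁, ∀ nt ≥ n₁, ∀ (nr : ℕ) (N : Network Ω nt nr),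
      N.IsEigenbeamforming P lam →
      Integrable (N.sinr L σ2) P ∧ Integrable (N.ase L σ2 lam) P ∧
      (nt / lam : ℝ) ≤ C * N.avgSinr P L σ2 ∧
      N.avgSinr P L σ2 ≤ C * (nt * nr / lam) ∧
      lam * Real.logb 2 (1 + nt / lam) ≤ C * N.avgAse P L σ2 lam ∧
      N.avgAse P L σ2 lam ≤ C * (lam * Real.logb 2 (1 + nt * nr / lam)) := by
  obtain ⟨C₀, hC₀, lam₀, hlam₀, hupper⟩ :=
    exists_lintegral_gain_zero_div_interference_le P hL hL0 hLt
  obtain ⟨ε, hε, hLε⟩ := hL.exists_half_le hL0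
  have hLpos := hL.zero_pos
  set K := (∫⁻ x : Plane, ENNReal.ofReal (L ‖x‖)).toReal + 1
  have hK : 0 < K := by positivity
  have hLK : ∫⁻ x : Plane, ENNReal.ofReal (L ‖x‖) ≤ ENNReal.ofReal K := by
    rw [ENNReal.le_ofReal_iff_toReal_le hL.lintegral_lt_top.ne hK.le]
    linarith
  have hexp : Real.exp (1 / 2) / 2 < 1 := by
    have h1 : Real.exp (1 / 2) ^ 2 = Real.exp 1 := by
      rw [← Real.exp_nat_mul]
      norm_num
    have h2 := Real.exp_one_lt_d9
    nlinarith [Real.exp_pos (1 / 2)]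
  obtain ⟨n₁, hn₁⟩ := exists_pow_lt_of_lt_one (show (0 : ℝ) < 1 / 8 by norm_num) hexp
  -- Moving constants out of `log₂ (1 + ·)` requires `A ≥ 1` for the upper bound and `c ≤ 1` for the
  -- lower one. The other entry of `c` is what remains of the SINR threshold once `lam ≥ 1` absorbs
  -- the noise into `(4 * K + σ2) * lam`.
  set A := 1 + L 0 * C₀
  set c := min 1 (L 0 / (4 * (4 * K + σ2)))
  have hA : 1 ≤ A := by
    have : 0 < L 0 * C₀ := by positivity
    linarith
  have hc : 0 < c := lt_min one_pos (by positivity)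
  have hc1 : c ≤ 1 := min_le_left _ _
  have hv : 0 < Real.pi * ε ^ 2 := by
    have := Real.pi_pos
    positivity
  refine ⟨A + 2 / c, by positivity, max (max lam₀ 1) (16 / (Real.pi * ε ^ 2)),
    lt_max_of_lt_left (lt_max_of_lt_right one_pos), n₁, fun lam hlam nt hnt nr N hN => ?_⟩
  have hlam0 : lam₀ ≤ lam := (le_max_left _ _).trans ((le_max_left _ _).trans hlam)
  have hlam1 : 1 ≤ lam := (le_max_right _ _).trans ((le_max_left _ _).trans hlam)
  have hlam2 : 16 ≤ lam * (Real.pi * ε ^ 2) := (div_le_iff₀ hv).1 ((le_max_right _ _).trans hlam)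
  have hlampos : 0 < lam := one_pos.trans_le hlam1
  have hup := hupper lam hlam0 nt nr N hN
  obtain ⟨hint, havg⟩ := hN.integrable_sinr_of_le hL hlampos.le hσ (by positivity) hup
  set x : ℝ := nt / lam
  set z : ℝ := nt * nr / lam
  have hx : 0 ≤ x := by positivity
  have hz : 0 ≤ z := by positivity
  have hAle : A ≤ A + 2 / c := by
    have : 0 < 2 / c := by positivity
    linarith
  have havg' : N.avgSinr P L σ2 ≤ A * z := havg.trans (by
    rw [← mul_assoc]
    exact mul_le_mul_of_nonneg_right (by linarith) hz)
  have hs : c * x ≤ L 0 / 2 * (nt / 2) / (4 * K * lam + σ2) := by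
    calc c * x ≤ L 0 / (4 * (4 * K + σ2)) * x := mul_le_mul_of_nonneg_right (min_le_right _ _) hx
      _ = L 0 / 2 * (nt / 2) / ((4 * K + σ2) * lam) := by
          simp only [x]
          field_simp
          ring
      _ ≤ _ := by
          gcongr
          nlinarith
  -- The three bad events have probabilities at most 1/8, 1/8 and 1/4.
  have hprob : P {ω | N.sinr L σ2 ω < c * x} ≤ ENNReal.ofReal (1 / 2) := by
    refine (measure_mono fun ω (hω : N.sinr L σ2 ω < c * x) => hω.trans_le hs).trans
      ((hN.measure_sinr_lt_le hL hlampos hσ (hup.trans_lt ENNReal.ofReal_lt_top) hε hLε hK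
        hLK).trans ?_)
    rw [← ENNReal.ofReal_add (by positivity) (by positivity),
      ← ENNReal.ofReal_add (by positivity) (by positivity)]
    refine ENNReal.ofReal_le_ofReal ?_
    have h1 : Real.exp (-(lam * (Real.pi * ε ^ 2) / 2)) ≤ 1 / 8 := by
      rw [Real.exp_neg, inv_le_comm₀ (Real.exp_pos _) (by norm_num)]
      have := Real.add_one_le_exp (lam * (Real.pi * ε ^ 2) / 2)
      linarith
    have h2 : (Real.exp (1 / 2) / 2) ^ nt ≤ 1 / 8 :=
      (pow_le_pow_of_le_one (by positivity) hexp.le hnt).trans hn₁.le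
    linarith
  obtain ⟨hlow, hlow'⟩ :=
    hN.half_mul_le_average hL hσ hlampos.le hint (mul_nonneg hc.le hx) hprob
  have hsinr0 : 0 ≤ N.avgSinr P L σ2 := integral_nonneg (N.sinr_nonneg hL hσ)
  have hscale {b d : ℝ} (hd : 0 ≤ d) (h : 1 / 2 * (c * b) ≤ d) : b ≤ (A + 2 / c) * d := by
    have h1 : b ≤ 2 / c * d := by
      rw [div_mul_eq_mul_div, le_div_iff₀ hc]
      linarith
    nlinarith
  have hlogx : 0 ≤ Real.logb 2 (1 + x) := Real.logb_nonneg one_lt_two (by linarith)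
  have hlogz : 0 ≤ Real.logb 2 (1 + z) := Real.logb_nonneg one_lt_two (by linarith)
  have hlogc := mul_logb_one_add_le hc hc1 hx
  have hase : 1 / 2 * (c * (lam * Real.logb 2 (1 + x))) ≤ N.avgAse P L σ2 lam := by
    refine le_trans ?_ hlow'
    nlinarith
  refine ⟨hint, hN.integrable_ase hL hσ hint, hscale hsinr0 hlow,
    havg'.trans (mul_le_mul_of_nonneg_right hAle hz), hscale (le_trans (by positivity) hase) hase,
    ?_⟩
  calc N.avgAse P L σ2 lam ≤ lam * Real.logb 2 (1 + N.avgSinr P L σ2) :=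
        hN.avgAse_le hL hσ hlampos.le hint
    _ ≤ lam * (A * Real.logb 2 (1 + z)) := by
        refine mul_le_mul_of_nonneg_left (le_trans ?_ (logb_one_add_mul_le hA hz)) hlampos.le
        exact Real.logb_le_logb_of_le one_lt_two (by linarith) (by linarith)
    _ = A * (lam * Real.logb 2 (1 + z)) := by ring
    _ ≤ _ := mul_le_mul_of_nonneg_right hAle (by positivity)

end Cellular

/-! ### Asymptotic bounds and comparison with MISO networks -/

theorem corollary2
    {Ω Ω₁ Ω₂ : Type*} [MeasurableSpace Ω] [MeasurableSpace Ω₁] [MeasurableSpace Ω₂]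
    (P : Measure Ω) [IsProbabilityMeasure P]
    (P₁ : Measure Ω₁) [IsProbabilityMeasure P₁]
    (P₂ : Measure Ω₂) [IsProbabilityMeasure P₂]
    -- the path loss function and the noise variance
    (L : ℝ → ℝ) (hL : Cellular.PhysicallyFeasible L)
    (hL0 : ContinuousWithinAt L (Set.Ici 0) 0)
    (hLt : Cellular.TailCondition L)
    (σ2 : ℝ) (hσ : 0 ≤ σ2)
    -- the numbers of transmit and receive antennas
    (Nt Nr : ℝ → ℕ)
    (hNt_pos : ∀ lam > 0, 1 ≤ Nt lam) (hNr_pos : ∀ lam > 0, 1 ≤ Nr lam)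
    (hNt_mono : MonotoneOn Nt (Set.Ioi 0)) (hNt_lim : Tendsto Nt atTop atTop)
    (y : ℝ) (hy : y ∈ Set.Icc (0 : ℝ) 1)
    (hratio : Tendsto (fun lam => (Nr lam : ℝ) / (Nt lam : ℝ)) atTop (𝓝 y))
    -- the MIMO networks, indexed by the density of base stations
    (net : ∀ lam : ℝ, Cellular.Network Ω (Nt lam) (Nr lam))
    (hnet : ∀ lam > 0, (net lam).IsEigenbeamforming P lam) :
    -- the interference is almost surely finite and the averages are finite at large densities
    (∀ lam > 0, ∀ᵐ ω ∂P, Summable fun i => (net lam).power L (i + 1) ω) ∧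
    (∀ᶠ lam in atTop,
      Integrable ((net lam).sinr L σ2) P ∧ Integrable ((net lam).ase L σ2 lam) P) ∧
    -- bounds for the average SINR
    (fun lam => (Nt lam : ℝ) / lam) =O[atTop] (fun lam => (net lam).avgSinr P L σ2) ∧
    (fun lam => (net lam).avgSinr P L σ2) =O[atTop]
      (fun lam => (Nt lam : ℝ) * (Nr lam : ℝ) / lam) ∧
    -- the average ASE is at least of the order of that of MISO networks with `Nt` antennas
    (∀ miso : ∀ lam : ℝ, Cellular.Network Ω₁ (Nt lam) 1,
      (∀ lam > 0, (miso lam).IsEigenbeamforming P₁ lam) →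
      (∀ᶠ lam in atTop, Integrable ((miso lam).ase L σ2 lam) P₁) ∧
      (fun lam => (miso lam).avgAse P₁ L σ2 lam) =O[atTop]
        (fun lam => (net lam).avgAse P L σ2 lam)) ∧
    -- the average ASE is at most of the order of that of MISO networks with `Nt * Nr` antennas
    (∀ miso : ∀ lam : ℝ, Cellular.Network Ω₂ (Nt lam * Nr lam) 1,
      (∀ lam > 0, (miso lam).IsEigenbeamforming P₂ lam) →
      (∀ᶠ lam in atTop, Integrable ((miso lam).ase L σ2 lam) P₂) ∧
      (fun lam => (net lam).avgAse P L σ2 lam) =O[atTop]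
        (fun lam => (miso lam).avgAse P₂ L σ2 lam)) ∧
    -- the same bounds with the explicit MISO scaling laws
    (fun lam => lam * Real.logb 2 (1 + (Nt lam : ℝ) / lam)) =O[atTop]
      (fun lam => (net lam).avgAse P L σ2 lam) ∧
    (fun lam => (net lam).avgAse P L σ2 lam) =O[atTop]
      (fun lam => lam * Real.logb 2 (1 + (Nt lam : ℝ) * (Nr lam : ℝ) / lam)) := by
  obtain ⟨C, hC, lam₁, hlam₁, n₁, hb⟩ := Cellular.exists_average_bounds P hL hL0 hLt hσ
  have hcast (lam : ℝ) : ((Nt lam * Nr lam : ℕ) : ℝ) = (Nt lam : ℝ) * (Nr lam : ℝ) :=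
    Nat.cast_mul _ _
  have hlarge (lam' : ℝ) (n : ℕ) : ∀ᶠ lam in atTop, lam' ≤ lam ∧ 0 < lam ∧ n ≤ Nt lam :=
    (eventually_ge_atTop lam').and
      ((eventually_gt_atTop 0).and (hNt_lim.eventually (eventually_ge_atTop n)))
  have hnonneg {lam z : ℝ} (hlam : 0 < lam) (hz : 0 ≤ z) :
      0 ≤ lam * Real.logb 2 (1 + z) :=
    mul_nonneg hlam.le (Real.logb_nonneg one_lt_two (by linarith))
  have hlower : (fun lam => lam * Real.logb 2 (1 + (Nt lam : ℝ) / lam)) =O[atTop]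
      (fun lam => (net lam).avgAse P L σ2 lam) :=
    Cellular.isBigO_of_eventually_le hC.le ((hlarge lam₁ n₁).mono fun lam h =>
      ⟨hnonneg h.2.1 (div_nonneg (Nat.cast_nonneg _) h.2.1.le),
        (hb lam h.1 _ h.2.2 _ _ (hnet lam h.2.1)).2.2.2.2.1⟩)
  have hupper : (fun lam => (net lam).avgAse P L σ2 lam) =O[atTop]
      (fun lam => lam * Real.logb 2 (1 + (Nt lam : ℝ) * (Nr lam : ℝ) / lam)) :=
    Cellular.isBigO_of_eventually_le hC.le ((hlarge lam₁ n₁).mono fun lam h =>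
      ⟨integral_nonneg fun ω => hnonneg h.2.1 ((net lam).sinr_nonneg hL hσ ω),
        (hb lam h.1 _ h.2.2 _ _ (hnet lam h.2.1)).2.2.2.2.2⟩)
  refine ⟨fun lam hlam => ?_, ?_, ?_, ?_, fun miso hmiso => ⟨?_, ?_⟩, fun miso hmiso => ⟨?_, ?_⟩,
    hlower, hupper⟩
  · exact ((hnet lam hlam).interference_ae_lt_top hL hlam.le).mono fun ω hω =>
      Cellular.Network.summable_power_of_interference_ne_top hL hω.ne
  · filter_upwards [hlarge lam₁ n₁] with lam h
    have := hb lam h.1 _ h.2.2 _ _ (hnet lam h.2.1)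
    exact ⟨this.1, this.2.1⟩
  · exact Cellular.isBigO_of_eventually_le hC.le ((hlarge lam₁ n₁).mono fun lam h =>
      ⟨div_nonneg (Nat.cast_nonneg _) h.2.1.le,
        (hb lam h.1 _ h.2.2 _ _ (hnet lam h.2.1)).2.2.1⟩)
  · exact Cellular.isBigO_of_eventually_le hC.le ((hlarge lam₁ n₁).mono fun lam h =>
      ⟨integral_nonneg ((net lam).sinr_nonneg hL hσ),
        (hb lam h.1 _ h.2.2 _ _ (hnet lam h.2.1)).2.2.2.1⟩)
  · obtain ⟨C', hC', lam', -, n', hb'⟩ := Cellular.exists_average_bounds P₁ hL hL0 hLt hσ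
    filter_upwards [hlarge lam' n'] with lam h
    exact (hb' lam h.1 _ h.2.2 _ _ (hmiso lam h.2.1)).2.1
  · obtain ⟨C', hC', lam', -, n', hb'⟩ := Cellular.exists_average_bounds P₁ hL hL0 hLt hσ
    -- The upper bound for a MISO network with `Nt` antennas has the order of the lower bound for
    -- the MIMO network.
    refine IsBigO.trans (Cellular.isBigO_of_eventually_le hC'.le
      ((hlarge lam' n').mono fun lam h =>
        ⟨integral_nonneg fun ω => hnonneg h.2.1 ((miso lam).sinr_nonneg hL hσ ω), ?_⟩)) hlower
    have := (hb' lam h.1 _ h.2.2 _ _ (hmiso lam h.2.1)).2.2.2.2.2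
    rwa [Nat.cast_one, mul_one] at this
  · obtain ⟨C', hC', lam', -, n', hb'⟩ := Cellular.exists_average_bounds P₂ hL hL0 hLt hσ
    filter_upwards [hlarge lam' n'] with lam h
    -- As `Nr ≥ 1`, the product `Nt * Nr` exceeds any antenna threshold that `Nt` exceeds.
    exact (hb' lam h.1 _ (h.2.2.trans (Nat.le_mul_of_pos_right _ (hNr_pos lam h.2.1))) _ _
      (hmiso lam h.2.1)).2.1
  · obtain ⟨C', hC', lam', -, n', hb'⟩ := Cellular.exists_average_bounds P₂ hL hL0 hLt hσ
    refine hupper.trans (Cellular.isBigO_of_eventually_le hC'.le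
      ((hlarge lam' n').mono fun lam h =>
        ⟨hnonneg h.2.1 (by have := h.2.1; positivity), ?_⟩))
    have := (hb' lam h.1 _ (h.2.2.trans (Nat.le_mul_of_pos_right _ (hNr_pos lam h.2.1))) _ _
      (hmiso lam h.2.1)).2.2.2.2.1
    rwa [hcast] at this
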